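/- Let $R>0$ and let $X_2=\{x\in\mathbb R^3: x\cdot x=-R^2\}$ be the two-dimensional de Sitter universe, where $x\cdot y=x^0y^0-x^1y^1-x^2y^2$, with the induced Lorentzian metric of signature $(+,-)$, invariant volume measure $d\sigma$ and Laplace–Beltrami (d'Alembert) operator $\square=|g|^{-1/2}\partial_i(|g|^{1/2}g^{ij}\partial_j)$. Let $\mathcal D(X_2)$ be the space of smooth compactly supported complex functions on $X_2$. Fix a constant $c\in\mathbb R$ and let $\mathcal W_0(x,x')$ be the boundary value, for $z\to x$ from the backward tube and $z'\to x'$ from the forward tube, of $$W_0(z,z')=c-\frac1{4\pi}\ln\Big[-\frac{(z-z')^2}{R^2}\Big],$$ i.e. $\mathcal W_0(x,x')=c-\frac1{4\pi}\Big(\ln\Big|\frac{(x-x')^2}{R^2}\Big|+i\pi\,\mathrm{sgn}(x^0-x'^0)\,1_{\{(x-x')^2>0\}}\Big)$. Put $$\langle f,g\rangle=\int_{X_2\times X_2}\mathcal W_0(x,x')\,\overline{f(x)}\,g(x')\,d\sigma(x)\,d\sigma(x').$$ Let $h\in\mathcal D(X_2)$ be real-valued with $\int h\,d\sigma=1$ and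 $\langle h,h\rangle=0$. For $f\in\mathcal D(X_2)$ put $f_0=f-(\int f\,d\sigma)\,h$, and define the Krein product $$(f,g)=\langle f_0,g_0\rangle+\langle f,h\rangle\langle h,g\rangle+\overline{\int f\,d\sigma}\int g\,d\sigma$$ and $\mathcal I_h=\{f\in\mathcal D(X_2):\int f\,d\sigma=0,\ \langle f_0,f_0\rangle=0,\ \langle h,f\rangle=0\}$. Finally let $v_0=-4\pi R^2\,\square h\in\mathcal D(X_2)$. Then: 1. $\mathcal W_0$ is locally integrable on $X_2\times X_2$; $(\cdot,\cdot)$ is a positive semidefinite Hermitian form on $\mathcal D(X_2)$, and $(f,f)=0$ if and only if $f\in\mathcal I_h$. Let $\mathcal K^{(1)}$ be the Hilbert space obtained by completing $\mathcal D(X_2)/\mathcal I_h$ with respect to $(\cdot,\cdot)$. 2. The functional $F_h(f)=\langle h,f\rangle$, $f\in\mathcal D(X_2)$, defines a continuous linear functional on $\mathcal K^{(1)}$ of norm $\|F_h\|=1$. It is represented by the class of $v_0$, that is, $(v_0,u)=F_h(u)$ for all $u\in\mathcal K^{(1)}$, and $v_0$ is normalized, $(v_0,v_0)=1$. 3. The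 class of $v_0$ does not depend on $h$: if $h'\in\mathcal D(X_2)$ is another real-valued function with $\int h'\,d\sigma=1$ and $\langle h',h'\rangle=0$, and $v_0'=-4\pi R^2\,\square h'$, then $v_0'-v_0\in\mathcal I_h$. 4. $\langle v_0,v_0\rangle=0$, and $\langle v_0,f\rangle=\int_{X_2}f\,d\sigma$ for every $f\in\mathcal D(X_2)$. -/

import Mathlib

open scoped ContDiff ComplexConjugate Topology

noncomputable section

namespace DeSitter

/-! ### The two-dimensional de Sitter universe -/

/-- The Minkowski product `x⁰y⁰ - x¹y¹ - x²y²` on `ℝ³`. -/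
def mink (x y : Fin 3 → ℝ) : ℝ := x 0 * y 0 - x 1 * y 1 - x 2 * y 2

/-- The complexified Minkowski product (bilinear) on `ℂ³`. -/
def minkC (z w : Fin 3 → ℂ) : ℂ := z 0 * w 0 - z 1 * w 1 - z 2 * w 2

/-- The hyperboloid `X₂(R) = {x ∈ ℝ³ : x² = -R²}`. -/
def X (R : ℝ) : Set (Fin 3 → ℝ) := {x | mink x x = -R ^ 2}

/-- The global parametrization
`(t, θ) ↦ (R sinh t, R cosh t cos θ, R cosh t sin θ)`, the universal covering of `X₂(R)`. -/
def chart (R : ℝ) (u : Fin 2 → ℝ) : Fin 3 → ℝ :=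
  ![R * Real.sinh (u 0), R * Real.cosh (u 0) * Real.cos (u 1),
    R * Real.cosh (u 0) * Real.sin (u 1)]

theorem chart_mem (R : ℝ) (u : Fin 2 → ℝ) : chart R u ∈ X R := by
  have h1 := Real.cosh_sq (u 0)
  have h2 := Real.sin_sq_add_cos_sq (u 1)
  simp only [X, mink, chart, Set.mem_ofPred_eq, Matrix.cons_val]
  linear_combination (-R ^ 2 * Real.cosh (u 0) ^ 2) * h2 - R ^ 2 * h1

/-- The parametrization as a map into `X₂(R)`. -/
def chartX (R : ℝ) (u : Fin 2 → ℝ) : X R := ⟨chart R u, chart_mem R u⟩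

/-- A right inverse of the parametrization, with `θ ∈ (-π, π]`. -/
def coords (R : ℝ) (x : X R) : Fin 2 → ℝ :=
  ![Real.arsinh (x.1 0 / R), Complex.arg ⟨x.1 1, x.1 2⟩]

/-- The partial derivative `∂F/∂uⁱ`. -/
def pd {E : Type*} [NormedAddCommGroup E] [NormedSpace ℝ E]
    (i : Fin 2) (F : (Fin 2 → ℝ) → E) (u : Fin 2 → ℝ) : E :=
  fderiv ℝ F u (Pi.single i 1)

/-- The de Sitter metric `g_{ij}` in the coordinates `(t, θ)`: the metric induced on `X₂(R)`
by the ambient Minkowski metric (signature `(+, -)`). -/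
def metric (R : ℝ) (u : Fin 2 → ℝ) : Matrix (Fin 2) (Fin 2) ℝ :=
  Matrix.of fun i j => mink (pd i (chart R) u) (pd j (chart R) u)

/-- The volume density `√|det g|`. -/
def volDensity (R : ℝ) (u : Fin 2 → ℝ) : ℝ := √|(metric R u).det|

/-- The invariant volume measure `dσ` on `X₂(R)`: the image of `√|det g| dt dθ` on
`ℝ × (-π, π]`, which the parametrization maps bijectively onto `X₂(R)`. -/
def σ (R : ℝ) : MeasureTheory.Measure (X R) :=
  ((MeasureTheory.volume.restrict {u : Fin 2 → ℝ | u 1 ∈ Set.Ioc (-Real.pi) Real.pi}).withDensity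
    fun u => ENNReal.ofReal (volDensity R u)).map (chartX R)

/-- The Laplace–Beltrami operator in coordinates:
`|g|^{-1/2} ∑ᵢⱼ ∂ᵢ (|g|^{1/2} g^{ij} ∂ⱼ F)`. -/
def laplaceBeltrami (R : ℝ) (F : (Fin 2 → ℝ) → ℂ) (u : Fin 2 → ℝ) : ℂ :=
  (volDensity R u)⁻¹ •
    ∑ i, ∑ j, pd i (fun w => (volDensity R w * (metric R w)⁻¹ i j) • pd j F w) u

/-- The space `𝓓(X₂)` of complex test functions: smooth functions on `X₂(R)` with compact support.
Since the parametrization is a surjective local diffeomorphism, `f` is smooth on `X₂(R)` if and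
only if it is smooth in the coordinates `(t, θ)`. -/
def TestFn (R : ℝ) : Submodule ℂ (X R → ℂ) where
  carrier := {f | ContDiff ℝ ∞ (f ∘ chartX R) ∧ HasCompactSupport f}
  add_mem' hf hg := ⟨hf.1.add hg.1, hf.2.add hg.2⟩
  zero_mem' := ⟨contDiff_const, HasCompactSupport.zero⟩
  smul_mem' a _ hf := ⟨contDiff_const.smul hf.1, hf.2.smul_left (f := fun _ => a)⟩

/-! #### The operator `□` maps test functions to test functions -/

theorem fderiv_chart_apply (R : ℝ) (u : Fin 2 → ℝ) (v : Fin 2 → ℝ) :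
    fderiv ℝ (chart R) u v =
      ![R * (Real.cosh (u 0) * v 0),
        R * (Real.sinh (u 0) * v 0) * Real.cos (u 1)
          - R * Real.cosh (u 0) * (Real.sin (u 1) * v 1),
        R * (Real.sinh (u 0) * v 0) * Real.sin (u 1)
          + R * Real.cosh (u 0) * (Real.cos (u 1) * v 1)] := by
  have h0 : HasFDerivAt (fun w : Fin 2 → ℝ => w 0)
      (ContinuousLinearMap.proj (R := ℝ) (φ := fun _ : Fin 2 => ℝ) 0) u :=
    (ContinuousLinearMap.proj (R := ℝ) (φ := fun _ : Fin 2 => ℝ) 0).hasFDerivAt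
  have h1 : HasFDerivAt (fun w : Fin 2 → ℝ => w 1)
      (ContinuousLinearMap.proj (R := ℝ) (φ := fun _ : Fin 2 => ℝ) 1) u :=
    (ContinuousLinearMap.proj (R := ℝ) (φ := fun _ : Fin 2 => ℝ) 1).hasFDerivAt
  have e0 := h0.sinh.const_mul R
  have e1 := (h0.cosh.const_mul R).mul h1.cos
  have e2 := (h0.cosh.const_mul R).mul h1.sin
  have hd : DifferentiableAt ℝ (chart R) u := by
    rw [differentiableAt_pi]
    intro i
    fin_cases i
    · exact e0.differentiableAt
    · exact e1.differentiableAt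
    · exact e2.differentiableAt
  funext i
  have key : fderiv ℝ (chart R) u v i = fderiv ℝ (fun w => chart R w i) u v := by
    rw [fderiv_apply hd]
    rfl
  rw [key]
  fin_cases i
  · have : fderiv ℝ (fun w => chart R w 0) u = _ := e0.fderiv
    simp [this]
  · have : fderiv ℝ (fun w => chart R w 1) u = _ := e1.fderiv
    simp [this]
    ring
  · have : fderiv ℝ (fun w => chart R w 2) u = _ := e2.fderiv
    simp [this]
    ring

/-- In the coordinates `(t, θ)` the metric is `R² (dt² - cosh² t dθ²)`. -/
theorem metric_eq (R : ℝ) (u : Fin 2 → ℝ) :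
    metric R u = !![R ^ 2, 0; 0, -(R ^ 2 * Real.cosh (u 0) ^ 2)] := by
  have h1 := Real.cosh_sq (u 0)
  have h2 := Real.sin_sq_add_cos_sq (u 1)
  ext i j
  fin_cases i <;> fin_cases j <;>
    simp [metric, pd, fderiv_chart_apply, mink]
  · linear_combination (-R ^ 2 * Real.sinh (u 0) ^ 2) * h2 + R ^ 2 * h1
  · ring
  · ring
  · linear_combination (-R ^ 2 * Real.cosh (u 0) ^ 2) * h2

theorem volDensity_eq (R : ℝ) (u : Fin 2 → ℝ) : volDensity R u = R ^ 2 * Real.cosh (u 0) := by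
  have h : (metric R u).det = -(R ^ 2 * Real.cosh (u 0)) ^ 2 := by
    rw [metric_eq, Matrix.det_fin_two_of]
    ring
  rw [volDensity, h, abs_neg, abs_of_nonneg (sq_nonneg _), Real.sqrt_sq]
  have := Real.cosh_pos (u 0)
  positivity

theorem metric_inv (R : ℝ) (hR : 0 < R) (u : Fin 2 → ℝ) :
    (metric R u)⁻¹ = !![(R ^ 2)⁻¹, 0; 0, -(R ^ 2 * Real.cosh (u 0) ^ 2)⁻¹] := by
  have hc := (Real.cosh_pos (u 0)).ne'
  apply Matrix.inv_eq_right_inv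
  rw [metric_eq]
  ext i j
  fin_cases i <;> fin_cases j <;> simp [Matrix.mul_apply, Fin.sum_univ_two] <;> field_simp

theorem contDiff_pd {F : (Fin 2 → ℝ) → ℂ} (hF : ContDiff ℝ ∞ F) (i : Fin 2) :
    ContDiff ℝ ∞ (pd i F) :=
  (hF.fderiv_right (m := ∞) (by simp)).clm_apply contDiff_const

theorem contDiff_laplaceBeltrami {R : ℝ} (hR : 0 < R) {F : (Fin 2 → ℝ) → ℂ}
    (hF : ContDiff ℝ ∞ F) : ContDiff ℝ ∞ (laplaceBeltrami R F) := by
  have hc : ContDiff ℝ ∞ fun w : Fin 2 → ℝ => Real.cosh (w 0) :=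
    Real.contDiff_cosh.comp (contDiff_apply ℝ ℝ 0)
  have hv : ContDiff ℝ ∞ (volDensity R) := by
    have : volDensity R = fun w => R ^ 2 * Real.cosh (w 0) := funext (volDensity_eq R)
    rw [this]
    exact contDiff_const.mul hc
  have hm : ∀ i j, ContDiff ℝ ∞ fun w => (metric R w)⁻¹ i j := by
    intro i j
    have hq : ContDiff ℝ ∞ fun w : Fin 2 → ℝ => -(R ^ 2 * Real.cosh (w 0) ^ 2)⁻¹ :=
      ((contDiff_const.mul (hc.pow 2)).inv fun w => by
        have := Real.cosh_pos (w 0)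
        positivity).neg
    simp only [metric_inv R hR]
    fin_cases i <;> fin_cases j
    · exact contDiff_const
    · exact contDiff_const
    · exact contDiff_const
    · exact hq
  have hi : ContDiff ℝ ∞ fun w => (volDensity R w)⁻¹ := hv.inv fun w => by
    rw [volDensity_eq]
    have := Real.cosh_pos (w 0)
    positivity
  exact hi.smul (ContDiff.sum fun i _ => ContDiff.sum fun j _ =>
    contDiff_pd ((hv.mul (hm i j)).smul (contDiff_pd hF j)) i)

theorem pd_periodic {E : Type*} [NormedAddCommGroup E] [NormedSpace ℝ E]
    {F : (Fin 2 → ℝ) → E} {s : Fin 2 → ℝ} (h : ∀ w, F (w + s) = F w)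
    (i : Fin 2) (u : Fin 2 → ℝ) : pd i F (u + s) = pd i F u := by
  unfold pd
  rw [← fderiv_comp_add_right]
  simp only [h]

theorem laplaceBeltrami_periodic {R : ℝ} {F : (Fin 2 → ℝ) → ℂ} {s : Fin 2 → ℝ}
    (hs : s 0 = 0) (h : ∀ w, F (w + s) = F w) (u : Fin 2 → ℝ) :
    laplaceBeltrami R F (u + s) = laplaceBeltrami R F u := by
  have hm : ∀ w, metric R (w + s) = metric R w := fun w => by simp [metric_eq, hs]
  have hv : ∀ w, volDensity R (w + s) = volDensity R w := fun w => by simp [volDensity, hm]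
  unfold laplaceBeltrami
  rw [hv]
  congr 1
  refine Finset.sum_congr rfl fun i _ => Finset.sum_congr rfl fun j _ => ?_
  exact pd_periodic (F := fun w => (volDensity R w * (metric R w)⁻¹ i j) • pd j F w)
    (fun w => by simp only [hm, hv, pd_periodic h]) i u

theorem laplaceBeltrami_eq_zero {R : ℝ} {F : (Fin 2 → ℝ) → ℂ} {u : Fin 2 → ℝ}
    (h : F =ᶠ[𝓝 u] 0) : laplaceBeltrami R F u = 0 := by
  have hp : ∀ (i : Fin 2) (G : (Fin 2 → ℝ) → ℂ) (w : Fin 2 → ℝ), G =ᶠ[𝓝 w] 0 → pd i G w = 0 := by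
    intro i G w hG
    rw [pd, hG.fderiv_eq]
    simp
  unfold laplaceBeltrami
  rw [Finset.sum_eq_zero, smul_zero]
  refine fun i _ => Finset.sum_eq_zero fun j _ => hp _ _ _ ?_
  filter_upwards [h.eventuallyEq_nhds] with w hw
  simp [hp j F w hw]

theorem continuous_chartX (R : ℝ) : Continuous (chartX R) := by
  refine Continuous.subtype_mk (continuous_pi fun i => ?_) _
  fin_cases i <;> simp [chart] <;> fun_prop

theorem chartX_coords {R : ℝ} (hR : 0 < R) (x : X R) : chartX R (coords R x) = x := by
  obtain ⟨x, hx⟩ := x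
  have hx' : x 0 * x 0 - x 1 * x 1 - x 2 * x 2 = -R ^ 2 := hx
  have hn : R * Real.cosh (Real.arsinh (x 0 / R)) = ‖(⟨x 1, x 2⟩ : ℂ)‖ := by
    rw [Real.cosh_arsinh, Complex.norm_eq_sqrt_sq_add_sq]
    have h : x 1 ^ 2 + x 2 ^ 2 = R ^ 2 * (1 + (x 0 / R) ^ 2) := by
      field_simp
      linear_combination -hx'
    rw [h, Real.sqrt_mul (sq_nonneg R), Real.sqrt_sq hR.le]
  apply Subtype.ext
  funext i
  fin_cases i
  · simp [chartX, chart, coords]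
    field_simp
  · simp [chartX, chart, coords, hn, -Real.cosh_arsinh]
  · simp [chartX, chart, coords, hn, -Real.cosh_arsinh]

theorem coords_chartX {R : ℝ} (hR : 0 < R) (u : Fin 2 → ℝ) :
    ∃ k : ℤ, coords R (chartX R u) = u + ![0, k * (2 * Real.pi)] := by
  have hc : 0 < R * Real.cosh (u 0) := mul_pos hR (Real.cosh_pos _)
  have hz : (⟨chart R u 1, chart R u 2⟩ : ℂ) =
      ((R * Real.cosh (u 0) : ℝ) : ℂ) * (Complex.cos (u 1) + Complex.sin (u 1) * Complex.I) := by
    apply Complex.ext <;> simp [chart, Complex.cos_ofReal_re, Complex.sin_ofReal_re, -Complex.ofReal_mul,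
      -Complex.ofReal_cosh, Complex.sin_ofReal_im, Complex.cos_ofReal_im]
  have ha : Complex.arg ⟨chart R u 1, chart R u 2⟩ =
      toIocMod Real.two_pi_pos (-Real.pi) (u 1) := by
    rw [hz, Complex.arg_mul_cos_add_sin_mul_I_eq_toIocMod hc]
  refine ⟨-toIocDiv Real.two_pi_pos (-Real.pi) (u 1), ?_⟩
  funext i
  fin_cases i
  · simp [coords, chartX, chart, hR.ne']
  · simp only [coords, chartX, Fin.mk_one, Matrix.cons_val_one, Matrix.cons_val_fin_one, ha,
      Pi.add_apply, toIocMod, zsmul_eq_mul]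
    push_cast
    ring

theorem chartX_periodic (R : ℝ) (k : ℤ) (u : Fin 2 → ℝ) :
    chartX R (u + ![0, k * (2 * Real.pi)]) = chartX R u := by
  apply Subtype.ext
  simp [chartX, chart, Real.cos_add_int_mul_two_pi, Real.sin_add_int_mul_two_pi]

/-- The function `□f` on `X₂(R)`. -/
def boxFun (R : ℝ) (f : X R → ℂ) (x : X R) : ℂ :=
  laplaceBeltrami R (f ∘ chartX R) (coords R x)

theorem boxFun_chartX {R : ℝ} (hR : 0 < R) (f : X R → ℂ) (u : Fin 2 → ℝ) :
    boxFun R f (chartX R u) = laplaceBeltrami R (f ∘ chartX R) u := by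
  obtain ⟨k, hk⟩ := coords_chartX hR u
  rw [boxFun, hk]
  exact laplaceBeltrami_periodic (by simp) (fun w => by
    rw [Function.comp_apply, chartX_periodic, Function.comp_apply]) u

theorem boxFun_mem {R : ℝ} (hR : 0 < R) {f : X R → ℂ} (hf : f ∈ TestFn R) :
    boxFun R f ∈ TestFn R := by
  refine ⟨?_, hf.2.mono' ?_⟩
  · have : boxFun R f ∘ chartX R = laplaceBeltrami R (f ∘ chartX R) :=
      funext fun u => boxFun_chartX hR f u
    rw [this]
    exact contDiff_laplaceBeltrami hR hf.1
  · intro x hx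
    by_contra hx'
    apply hx
    apply laplaceBeltrami_eq_zero
    have h0 : f =ᶠ[𝓝 (chartX R (coords R x))] 0 := by
      rw [chartX_coords hR]
      exact notMem_tsupport_iff_eventuallyEq.mp hx'
    exact (continuous_chartX R).continuousAt.eventually h0

/-- The Laplace–Beltrami (d'Alembert) operator `□ : 𝓓(X₂) → 𝓓(X₂)`. -/
def box {R : ℝ} (hR : 0 < R) (f : TestFn R) : TestFn R :=
  ⟨boxFun R f, boxFun_mem hR f.2⟩

/-! ### The two-point function -/

/-- The open forward light cone `V⁺` of `ℝ³`. -/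
def Vplus : Set (Fin 3 → ℝ) := {y | 0 < mink y y ∧ 0 < y 0}

/-- The forward tube `T⁺ = ℝ³ + i V⁺`. -/
def Tplus : Set (Fin 3 → ℂ) := {z | (fun i => (z i).im) ∈ Vplus}

/-- The backward tube `T⁻ = ℝ³ + i V⁻ = ℝ³ - i V⁺`. -/
def Tminus : Set (Fin 3 → ℂ) := {z | (fun i => -(z i).im) ∈ Vplus}

/-- The analytic two-point function `W₀(z, z') = c - (1/4π) ln[-(z - z')²/R²]`, where `c` is an
additive renormalization constant. -/
def W₀ (R c : ℝ) (z z' : Fin 3 → ℂ) : ℂ :=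
  c - 1 / (4 * Real.pi) * Complex.log (-minkC (z - z') (z - z') / R ^ 2)

/-- The boundary value `𝒲₀(x, x')` of `W₀(z, z')` as `z → x` from the backward tube and `z' → x'`
from the forward tube (see `tendsto_W₀`). It is a locally integrable function, which is given here
explicitly; its values on the null set `(x - x')² = 0` are irrelevant. -/
def W (R c : ℝ) (x x' : Fin 3 → ℝ) : ℂ :=
  c - 1 / (4 * Real.pi) *
    (Real.log |mink (x - x') (x - x') / R ^ 2| +
      if 0 < mink (x - x') (x - x') then
        Complex.I * Real.pi * Real.sign (x 0 - x' 0) else 0)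

theorem mink_pos {y y' : Fin 3 → ℝ} (hy : y ∈ Vplus) (hy' : y' ∈ Vplus) : 0 < mink y y' := by
  obtain ⟨h1, h2⟩ := hy
  obtain ⟨h1', h2'⟩ := hy'
  unfold mink at *
  have hp : 0 < y 0 * y' 0 := mul_pos h2 h2'
  have h : (y 1 * y' 1 + y 2 * y' 2) ^ 2 < (y 0 * y' 0) ^ 2 := by
    nlinarith [sq_nonneg (y 1 * y' 2 - y 2 * y' 1), mul_pos h1 h1',
      mul_nonneg h1.le (add_nonneg (sq_nonneg (y' 1)) (sq_nonneg (y' 2))),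
      mul_nonneg h1'.le (add_nonneg (sq_nonneg (y 1)) (sq_nonneg (y 2)))]
  have := abs_lt_of_sq_lt_sq h hp.le
  linarith [(abs_lt.mp this).2]

theorem Vplus_add {y y' : Fin 3 → ℝ} (hy : y ∈ Vplus) (hy' : y' ∈ Vplus) : y + y' ∈ Vplus := by
  refine ⟨?_, add_pos hy.2 hy'.2⟩
  have h := mink_pos hy hy'
  have h1 := hy.1
  have h2 := hy'.1
  simp only [mink, Pi.add_apply] at *
  linarith

theorem isOpen_Vplus : IsOpen Vplus := by
  have h : Vplus = {y | 0 < mink y y} ∩ {y | 0 < y 0} := by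
    ext y
    simp [Vplus]
  rw [h]
  refine (isOpen_lt continuous_const ?_).inter (isOpen_lt continuous_const (continuous_apply 0))
  unfold mink
  fun_prop

/-- Off the light cone, `W R c x x'` is the boundary value of the analytic function `W₀` from the
tube `T⁻ × T⁺`. -/
theorem tendsto_W₀ {R : ℝ} (hR : 0 < R) (c : ℝ) (x x' : Fin 3 → ℝ)
    (hx : mink (x - x') (x - x') ≠ 0) :
    Filter.Tendsto (fun p : (Fin 3 → ℂ) × (Fin 3 → ℂ) => W₀ R c p.1 p.2)
      (𝓝[Tminus ×ˢ Tplus] (fun i => (x i : ℂ), fun i => (x' i : ℂ))) (𝓝 (W R c x x')) := by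
  set P : (Fin 3 → ℂ) × (Fin 3 → ℂ) := (fun i => (x i : ℂ), fun i => (x' i : ℂ)) with hP
  set q : (Fin 3 → ℂ) × (Fin 3 → ℂ) → ℂ :=
    fun p => -minkC (p.1 - p.2) (p.1 - p.2) / R ^ 2 with hq
  have hqc : Continuous q := by
    simp only [hq, minkC]
    fun_prop
  have hq0 : q P = ((-(mink (x - x') (x - x') / R ^ 2) : ℝ) : ℂ) := by
    simp only [hq, hP, minkC, mink, Pi.sub_apply]
    push_cast
    ring
  have hre : (q P).re = -(mink (x - x') (x - x') / R ^ 2) := by rw [hq0, Complex.ofReal_re]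
  have him : (q P).im = 0 := by rw [hq0, Complex.ofReal_im]
  have hnorm : ‖q P‖ = |mink (x - x') (x - x') / R ^ 2| := by
    rw [hq0, Complex.norm_real, Real.norm_eq_abs, abs_neg]
  have hR2 : 0 < R ^ 2 := by positivity
  have himq : ∀ p, (q p).im = 2 * mink (fun i => (p.1 i).re - (p.2 i).re)
      (fun i => -(p.1 i).im + (p.2 i).im) / R ^ 2 := by
    intro p
    have h1 : q p = -minkC (p.1 - p.2) (p.1 - p.2) / ((R ^ 2 : ℝ) : ℂ) := by
      simp only [hq]
      push_cast
      ring
    rw [h1, Complex.div_ofReal_im]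
    congr 1
    simp [minkC, mink]
    ring
  suffices hlog : Filter.Tendsto (fun p => Complex.log (q p)) (𝓝[Tminus ×ˢ Tplus] P)
      (𝓝 (Real.log |mink (x - x') (x - x') / R ^ 2| +
        if 0 < mink (x - x') (x - x') then
          Complex.I * Real.pi * Real.sign (x 0 - x' 0) else 0)) by
    exact tendsto_const_nhds.sub (tendsto_const_nhds.mul hlog)
  have hqt : Filter.Tendsto q (𝓝[Tminus ×ˢ Tplus] P) (𝓝 (q P)) :=
    (hqc.tendsto P).mono_left nhdsWithin_le_nhds
  rcases lt_or_gt_of_ne hx with hs | hs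
  · rw [if_neg hs.not_gt, add_zero]
    have hpos : 0 < -(mink (x - x') (x - x') / R ^ 2) := by
      rw [← neg_div]
      exact div_pos (neg_pos.mpr hs) hR2
    have hslit : q P ∈ Complex.slitPlane := Or.inl (by rw [hre]; exact hpos)
    have hval : Complex.log (q P) = Real.log |mink (x - x') (x - x') / R ^ 2| := by
      rw [hq0, ← Complex.ofReal_log hpos.le, ← abs_neg, abs_of_pos hpos]
    rw [← hval]
    exact hqt.clog hslit
  · rw [if_pos hs]
    have hneg : (q P).re < 0 := by
      rw [hre]
      exact neg_neg_of_pos (div_pos hs hR2)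
    -- The imaginary part of `q` on the tube has the sign of `x⁰ - x'⁰`.
    have hcone : ∀ p ∈ Tminus ×ˢ Tplus, (fun i => -(p.1 i).im + (p.2 i).im) ∈ Vplus :=
      fun p hp => Vplus_add hp.1 hp.2
    have hd : x 0 - x' 0 ≠ 0 := by
      intro h0
      simp only [mink, Pi.sub_apply, h0] at hs
      nlinarith [sq_nonneg (x 1 - x' 1), sq_nonneg (x 2 - x' 2)]
    rcases lt_or_gt_of_ne hd with h0 | h0
    · have hev : ∀ᶠ p in 𝓝[Tminus ×ˢ Tplus] P, q p ∈ {z : ℂ | z.im < 0} := by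
        have hopen : IsOpen ((fun (p : (Fin 3 → ℂ) × (Fin 3 → ℂ)) (i : Fin 3) =>
            -((p.1 i).re - (p.2 i).re)) ⁻¹' Vplus) :=
          isOpen_Vplus.preimage (by fun_prop)
        have hmem : P ∈ (fun (p : (Fin 3 → ℂ) × (Fin 3 → ℂ)) (i : Fin 3) =>
            -((p.1 i).re - (p.2 i).re)) ⁻¹' Vplus := by
          refine ⟨?_, ?_⟩
          · simp only [mink, Pi.sub_apply] at hs
            simp only [hP, mink, Complex.ofReal_re]
            linarith
          · simp only [hP, Complex.ofReal_re]
            linarith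
        filter_upwards [self_mem_nhdsWithin, mem_nhdsWithin_of_mem_nhds (hopen.mem_nhds hmem)]
          with p hp hp'
        have hm := mink_pos hp' (hcone p hp)
        have h3 : (q p).im < 0 := by
          rw [himq]
          apply div_neg_of_neg_of_pos _ hR2
          simp only [mink] at hm ⊢
          linarith
        exact h3
      have ht := (Complex.tendsto_log_nhdsWithin_im_neg_of_re_neg_of_im_zero hneg him).comp
        (tendsto_nhdsWithin_iff.mpr ⟨hqt, hev⟩)
      rw [hnorm] at ht
      rw [Real.sign_of_neg h0]
      convert ht using 2
      · rfl
      · push_cast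
        ring
    · have hev : ∀ᶠ p in 𝓝[Tminus ×ˢ Tplus] P, q p ∈ {z : ℂ | 0 ≤ z.im} := by
        have hopen : IsOpen ((fun (p : (Fin 3 → ℂ) × (Fin 3 → ℂ)) (i : Fin 3) =>
            (p.1 i).re - (p.2 i).re) ⁻¹' Vplus) :=
          isOpen_Vplus.preimage (by fun_prop)
        have hmem : P ∈ (fun (p : (Fin 3 → ℂ) × (Fin 3 → ℂ)) (i : Fin 3) =>
            (p.1 i).re - (p.2 i).re) ⁻¹' Vplus := by
          refine ⟨?_, ?_⟩
          · simp only [mink, Pi.sub_apply] at hs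
            simp only [hP, mink, Complex.ofReal_re]
            linarith
          · simp only [hP, Complex.ofReal_re]
            linarith
        filter_upwards [self_mem_nhdsWithin, mem_nhdsWithin_of_mem_nhds (hopen.mem_nhds hmem)]
          with p hp hp'
        have hm := mink_pos hp' (hcone p hp)
        have h3 : 0 ≤ (q p).im := by
          rw [himq]
          positivity
        exact h3
      have ht := (Complex.tendsto_log_nhdsWithin_im_nonneg_of_re_neg_of_im_zero hneg him).comp
        (tendsto_nhdsWithin_iff.mpr ⟨hqt, hev⟩)
      rw [hnorm] at ht
      rw [Real.sign_of_pos h0]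
      convert ht using 2
      · rfl
      · push_cast
        ring

/-! ### The Krein space -/

/-- The sesquilinear form `⟨f, g⟩ = ∫∫ 𝒲₀(x, x') conj(f(x)) g(x') dσ(x) dσ(x')`. -/
def form (R c : ℝ) (f g : X R → ℂ) : ℂ :=
  ∫ p : X R × X R, W R c p.1 p.2 * conj (f p.1) * g p.2 ∂((σ R).prod (σ R))

/-- The total integral `∫ f dσ`. -/
def integ {R : ℝ} (f : X R → ℂ) : ℂ := ∫ x, f x ∂(σ R)

/-- The fixed function `h`: a real test function with `∫ h dσ = 1` and `⟨h, h⟩ = 0`. -/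
structure IsAdmissible (R c : ℝ) (h : TestFn R) : Prop where
  real : ∀ x : X R, (h.1 x).im = 0
  integral_eq_one : integ h.1 = 1
  form_self : form R c h h = 0

/-- The component `f₀ = f - (∫ f dσ) h` of `f` in the space `𝓓₀` of test functions with zero
integral. -/
def zeroPart {R : ℝ} (h f : TestFn R) : TestFn R := f - integ f.1 • h

/-- The Krein product
`(f, g) = ⟨f₀, g₀⟩ + ⟨f, h⟩⟨h, g⟩ + conj(∫ f dσ) ∫ g dσ`. -/
def krein (R c : ℝ) (h f g : TestFn R) : ℂ :=
  form R c (zeroPart h f) (zeroPart h g) + form R c f h * form R c h g +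
    conj (integ f.1) * integ g.1

/-- The subspace `𝓘_h = {f ∈ 𝓓₀ : ⟨f₀, f₀⟩ = 0, ⟨h, f⟩ = 0}`. -/
def nullIdeal (R c : ℝ) (h : TestFn R) : Set (TestFn R) :=
  {f | integ f.1 = 0 ∧ form R c (zeroPart h f) (zeroPart h f) = 0 ∧ form R c h f = 0}

/-- The Krein product is a positive semidefinite Hermitian form on `𝓓(X₂)`, antilinear in the
first argument. -/
structure IsPreHilbert (R c : ℝ) (h : TestFn R) : Prop where
  conj_symm : ∀ f g, conj (krein R c h g f) = krein R c h f g
  re_nonneg : ∀ f, 0 ≤ (krein R c h f f).re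
  add_left : ∀ f₁ f₂ g, krein R c h (f₁ + f₂) g = krein R c h f₁ g + krein R c h f₂ g
  smul_left : ∀ f g (a : ℂ), krein R c h (a • f) g = conj a * krein R c h f g

/-- The space `𝓓(X₂)`, to be equipped with the Krein product. -/
def PreK {R c : ℝ} {h : TestFn R} (_H : IsPreHilbert R c h) : Type := TestFn R

section PreK

variable {R c : ℝ} {h : TestFn R} (H : IsPreHilbert R c h)

instance : AddCommGroup (PreK H) := inferInstanceAs (AddCommGroup (TestFn R))

instance : Module ℂ (PreK H) := inferInstanceAs (Module ℂ (TestFn R))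

/-- The Krein product as a pre-inner product. -/
@[reducible]
def preCore : PreInnerProductSpace.Core ℂ (PreK H) where
  inner f g := krein R c h f g
  conj_inner_symm := H.conj_symm
  re_inner_nonneg := H.re_nonneg
  add_left := H.add_left
  smul_left := H.smul_left

instance : SeminormedAddCommGroup (PreK H) :=
  @InnerProductSpace.Core.toSeminormedAddCommGroup ℂ (PreK H) _ _ _ (preCore H)

instance : InnerProductSpace ℂ (PreK H) := InnerProductSpace.ofCore (preCore H)

/-- The Hilbert space `𝒦⁽¹⁾`: the completion of the quotient of `𝓓(X₂)`, with the Krein product, by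
the subspace of vectors of zero norm. -/
abbrev K₁ : Type := UniformSpace.Completion (SeparationQuotient (PreK H))

/-- The class in `𝒦⁽¹⁾` of a test function. -/
def toK₁ (f : TestFn R) : K₁ H :=
  ((SeparationQuotient.mk (show PreK H from f) : SeparationQuotient (PreK H)) :
    UniformSpace.Completion (SeparationQuotient (PreK H)))

theorem inner_toK₁ (f g : TestFn R) :
    inner ℂ (toK₁ H f) (toK₁ H g) = krein R c h f g := by
  unfold toK₁
  rw [UniformSpace.Completion.inner_coe, SeparationQuotient.inner_mk_mk]
  rfl

end PreK

/-- The test function `v₀ = -4πR² □h`. -/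
def v₀ {R : ℝ} (hR : 0 < R) (h : TestFn R) : TestFn R :=
  ((-4 * Real.pi * R ^ 2 : ℝ) : ℂ) • box hR h

end DeSitter

end

open DeSitter

open scoped ENNReal
open MeasureTheory Set Filter

noncomputable section

namespace DeSitter


/-! With `tan η = sinh t` the metric is conformally flat, and massless waves are functions of the
null coordinates `η ± θ`. The unimodular functions `m_s = e^{i(η + sθ)}`, `s = ±1`, are algebraic on
the hyperboloid, and `-(x - x')²/R²` is the product of `1 + i x⁰/R`, `1 - i x'⁰/R` and the two
factors `1 - conj (m_s x) * m_s x'` (`mink_factorization`). All four factors lie in the closed right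
half plane, so the logarithms add without a branch error (`log_add_four`). Up to the constant `c`
and the factor `-1/(4π)`, the two-point function is thus `conj (L x) + L x' + ∑_s log (1 - conj (m_s
x) * m_s x')` with `L = log (1 - i x⁰/R)` (`W_eq_Wdamped`).

Local integrability reduces to that of `log |1 - e^{iθ}|` over a period, uniformly in the phase. For
positivity, the terms with `c` and `L` carry a factor `conj ∫ f` or `∫ g` and drop out on functions
of zero integral. The rest is a positive combination of the rank-one kernels `conj (m_s x)ⁿ * (m_s
x')ⁿ / n`. To exchange sum and integral the modes are first damped by `r < 1`; then `r → 1` by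
dominated convergence (`hasSum_modeForm`, `tendsto_form`).

The powers of `m_s` satisfy `□ m_sⁿ = 0`, whereas `□ L = 1/R²`. As `□` is symmetric
(`integral_box_mul`), `v₀ = -4πR² □h` has zero integral, vanishing mode coefficients, and `∫ L v₀ =
-4π` for every `h` with `∫ h = 1`. Of the expansion of `⟨v₀, f⟩` only `-(1/4π)(-4π) ∫ f = ∫ f`
remains (`form_v₀`). The claims about `v₀` follow algebraically: `(v₀, f) = ⟨h, f⟩`, `(v₀, v₀) =
conj ⟨v₀, h⟩ = 1`, `⟨v₀, v₀⟩ = ∫ v₀ = 0`, and a change of `h` alters `v₀` by a vector whose form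
with every test function is zero. -/

/-! ### The invariant measure in coordinates -/

/-- The parametrization as a function on `ℝ × ℝ`. -/
def param (R : ℝ) (p : ℝ × ℝ) : X R := chartX R ![p.1, p.2]

/-- The interval `(-π, π]` of the angular coordinate. -/
abbrev angles : Set ℝ := Ioc (-Real.pi) Real.pi

/-- The invariant measure in the coordinates `(t, θ)`. -/
def coordMeasure (R : ℝ) : Measure (ℝ × ℝ) :=
  ((volume : Measure ℝ).prod (volume.restrict angles)).withDensity
    fun p => ENNReal.ofReal (R ^ 2 * Real.cosh p.1)

theorem continuous_param (R : ℝ) : Continuous (param R) := by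
  refine (continuous_chartX R).comp (continuous_pi fun i => ?_)
  fin_cases i
  · exact continuous_fst
  · exact continuous_snd

theorem measurable_volDensity (R : ℝ) :
    Measurable fun u : Fin 2 → ℝ => ENNReal.ofReal (volDensity R u) := by
  have : volDensity R = fun w => R ^ 2 * Real.cosh (w 0) := funext (volDensity_eq R)
  rw [this]
  have := Real.continuous_cosh
  fun_prop

theorem measurable_coordDensity (R : ℝ) :
    Measurable fun p : ℝ × ℝ => ENNReal.ofReal (R ^ 2 * Real.cosh p.1) := by
  have := Real.continuous_cosh
  fun_prop

/-- Replaces `Fin 2 → ℝ` by the product `ℝ × ℝ`, on which Tonelli and Fubini apply; the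
identification of the two spaces preserves volume. -/
theorem σ_eq_map_param (R : ℝ) : σ R = (coordMeasure R).map (param R) := by
  refine Measure.ext_of_lintegral _ fun f hf => ?_
  have hs : MeasurableSet {u : Fin 2 → ℝ | u 1 ∈ Ioc (-Real.pi) Real.pi} :=
    measurable_pi_apply 1 measurableSet_Ioc
  have hmp := (volume_preserving_finTwoArrow ℝ).symm
  rw [σ, lintegral_map hf (continuous_chartX R).measurable,
    lintegral_map hf (continuous_param R).measurable, coordMeasure,
    lintegral_withDensity_eq_lintegral_mul _ (measurable_volDensity R)
      (g := fun u => f (chartX R u)) (hf.comp (continuous_chartX R).measurable),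
    lintegral_withDensity_eq_lintegral_mul _ (measurable_coordDensity R)
      (g := fun p => f (param R p)) (hf.comp (continuous_param R).measurable),
    ← hmp.setLIntegral_comp_preimage hs]
  · have hp : (MeasurableEquiv.finTwoArrow.symm : ℝ × ℝ → (Fin 2 → ℝ)) ⁻¹'
        {u : Fin 2 → ℝ | u 1 ∈ Ioc (-Real.pi) Real.pi} = univ ×ˢ angles := by
      ext p
      simp [MeasurableEquiv.finTwoArrow, angles]
    rw [hp, Measure.volume_eq_prod, ← Measure.prod_restrict, Measure.restrict_univ]
    refine lintegral_congr fun p => ?_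
    simp only [Pi.mul_apply, volDensity_eq]
    rfl
  · exact (measurable_volDensity R).mul (hf.comp (continuous_chartX R).measurable)

instance (R : ℝ) : SFinite (coordMeasure R) := by
  unfold coordMeasure
  infer_instance

instance (R : ℝ) : SFinite (σ R) := by
  rw [σ_eq_map_param]
  infer_instance

theorem lintegral_σ (R : ℝ) {f : X R → ℝ≥0∞} (hf : Measurable f) :
    ∫⁻ x, f x ∂σ R =
      ∫⁻ t, ENNReal.ofReal (R ^ 2 * Real.cosh t) * ∫⁻ θ in angles, f (param R (t, θ)) := by
  have hm : Measurable fun p => f (param R p) := hf.comp (continuous_param R).measurable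
  rw [σ_eq_map_param, lintegral_map hf (continuous_param R).measurable, coordMeasure,
    lintegral_withDensity_eq_lintegral_mul _ (measurable_coordDensity R) hm,
    lintegral_prod _ ((measurable_coordDensity R).mul hm).aemeasurable]
  refine lintegral_congr fun t => ?_
  simp only [Pi.mul_apply]
  exact lintegral_const_mul _ (hm.comp measurable_prodMk_left)

theorem integral_σ (R : ℝ) {f : X R → ℂ} (hf : Measurable f) :
    ∫ x, f x ∂σ R = ∫ p, (R ^ 2 * Real.cosh p.1) • f (param R p)
      ∂((volume : Measure ℝ).prod (volume.restrict angles)) := by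
  rw [σ_eq_map_param, integral_map (continuous_param R).aemeasurable hf.aestronglyMeasurable,
    coordMeasure, integral_withDensity_eq_integral_toReal_smul (measurable_coordDensity R)
      (by simp)]
  refine integral_congr_ae (.of_forall fun p => ?_)
  have := Real.cosh_pos p.1
  simp only
  rw [ENNReal.toReal_ofReal (by positivity)]

/-! ### Slabs and bounded functions supported in them -/

/-- The slab `|x⁰| ≤ M` of the hyperboloid. -/
def slab (R M : ℝ) : Set (X R) := {x | |x.1 0| ≤ M}

theorem continuous_coord (R : ℝ) (i : Fin 3) : Continuous fun x : X R => x.1 i :=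
  (continuous_apply i).comp continuous_subtype_val

theorem measurableSet_slab (R M : ℝ) : MeasurableSet (slab R M) :=
  (isClosed_le (continuous_coord R 0).abs continuous_const).measurableSet

/-- Follows from `x⁰ = R sinh t` and `|t| ≤ |sinh t|`. -/
theorem abs_le_of_param_mem_slab {R : ℝ} (hR : 0 < R) {M : ℝ} {p : ℝ × ℝ}
    (hp : param R p ∈ slab R M) : |p.1| ≤ M / R := by
  have h1 : |R * Real.sinh p.1| ≤ M := hp
  rw [abs_mul, abs_of_pos hR] at h1
  have h2 : |p.1| ≤ |Real.sinh p.1| := by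
    rw [Real.abs_sinh]
    exact Real.self_le_sinh_iff.mpr (abs_nonneg _)
  rw [le_div_iff₀ hR]
  nlinarith

/-- Integrating over a slab, with a bound on the integral over the circles `x⁰ = const`. -/
theorem setLIntegral_slab_le {R : ℝ} (hR : 0 < R) (M : ℝ) {f : X R → ℝ≥0∞} (hf : Measurable f)
    (C : ℝ≥0∞) (hC : ∀ t, ∫⁻ θ in angles, f (param R (t, θ)) ≤ C) :
    ∫⁻ x in slab R M, f x ∂σ R ≤
      (∫⁻ t in Icc (-(M / R)) (M / R), ENNReal.ofReal (R ^ 2 * Real.cosh t)) * C := by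
  have hcm : Measurable fun t : ℝ => ENNReal.ofReal (R ^ 2 * Real.cosh t) := by
    have := Real.continuous_cosh
    fun_prop
  rw [← lintegral_indicator (measurableSet_slab R M),
    lintegral_σ R (hf.indicator (measurableSet_slab R M)), ← lintegral_mul_const _ hcm,
    ← lintegral_indicator measurableSet_Icc]
  refine lintegral_mono fun t => ?_
  by_cases ht : t ∈ Icc (-(M / R)) (M / R)
  · rw [indicator_of_mem ht]
    gcongr
    refine le_trans (lintegral_mono fun θ => ?_) (hC t)
    exact indicator_le_self _ _ _
  · rw [indicator_of_notMem ht]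
    have : ∀ θ, (slab R M).indicator f (param R (t, θ)) = 0 := fun θ =>
      indicator_of_notMem (fun hm => ht (abs_le.mp (abs_le_of_param_mem_slab hR hm))) _
    simp [this]

theorem lintegral_cosh_lt_top (R M : ℝ) :
    ∫⁻ t in Icc (-M) M, ENNReal.ofReal (R ^ 2 * Real.cosh t) < ⊤ := by
  have hc : Continuous fun t : ℝ => R ^ 2 * Real.cosh t :=
    continuous_const.mul Real.continuous_cosh
  exact (hc.integrableOn_Icc).lintegral_lt_top

theorem σ_slab_lt_top {R : ℝ} (hR : 0 < R) (M : ℝ) : σ R (slab R M) < ⊤ := by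
  have := setLIntegral_slab_le hR M (f := fun _ => 1) measurable_const
    (volume angles) (fun t => by rw [lintegral_one, Measure.restrict_apply_univ])
  rw [setLIntegral_one] at this
  refine this.trans_lt (ENNReal.mul_lt_top (lintegral_cosh_lt_top _ _) (by simp))

theorem measurable_coords (R : ℝ) : Measurable (coords R) := by
  refine measurable_pi_lambda _ fun i => ?_
  fin_cases i
  · exact (Real.continuous_arsinh.measurable.comp
      ((continuous_coord R 0).div_const R).measurable)
  · have h : Measurable fun x : X R => (⟨x.1 1, x.1 2⟩ : ℂ) := by
      have : (fun x : X R => (⟨x.1 1, x.1 2⟩ : ℂ)) =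
          fun x : X R => (x.1 1 : ℂ) + (x.1 2 : ℂ) * Complex.I := by
        funext x
        apply Complex.ext <;> simp
      rw [this]
      exact ((Complex.measurable_ofReal.comp (continuous_coord R 1).measurable).add
        ((Complex.measurable_ofReal.comp (continuous_coord R 2).measurable).mul_const _))
    exact Complex.measurable_arg.comp h

/-- The right inverse `coords` jumps at the angle `π`, so it transports measurability only; the
integrals need no more. -/
theorem measurable_of_comp_chartX {R : ℝ} (hR : 0 < R) {f : X R → ℂ}
    (hf : Continuous (f ∘ chartX R)) : Measurable f := by
  have : f = (f ∘ chartX R) ∘ coords R := by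
    funext x
    simp [chartX_coords hR]
  rw [this]
  exact hf.measurable.comp (measurable_coords R)

/-- Measurable functions that are bounded and vanish outside a slab. -/
structure IsSlabBounded {R : ℝ} (f : X R → ℂ) (M C : ℝ) : Prop where
  measurable : Measurable f
  bound : ∀ x, ‖f x‖ ≤ C
  eq_zero : ∀ x, x ∉ slab R M → f x = 0

theorem exists_slab_of_hasCompactSupport {R : ℝ} {f : X R → ℂ} (hf : HasCompactSupport f) :
    ∃ M, ∀ x, x ∉ slab R M → f x = 0 := by
  obtain ⟨M, hM⟩ := IsCompact.exists_bound_of_continuousOn hf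
    (continuous_coord R 0).continuousOn
  refine ⟨M, fun x hx => ?_⟩
  by_contra h0
  exact hx (hM x (subset_tsupport f h0))

theorem exists_isSlabBounded {R : ℝ} (hR : 0 < R) (f : TestFn R) :
    ∃ M C, IsSlabBounded f.1 M C := by
  obtain ⟨M, hM⟩ := exists_slab_of_hasCompactSupport f.2.2
  -- This rectangle contains the coordinates of every point of the slab, so a bound on it is a bound
  -- on the slab.
  have hK : IsCompact (Icc ![-(M / R), -Real.pi] ![M / R, Real.pi] : Set (Fin 2 → ℝ)) :=
    isCompact_Icc
  obtain ⟨C, hC⟩ := hK.exists_bound_of_continuousOn f.2.1.continuous.continuousOn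
  -- The maximum with `0` serves the points off the slab: `C` may be negative if the rectangle is
  -- empty.
  refine ⟨M, max C 0, measurable_of_comp_chartX hR f.2.1.continuous, fun x => ?_, hM⟩
  by_cases hx : x ∈ slab R M
  · have h1 := hC (coords R x) ?_
    · rw [Function.comp_apply, chartX_coords hR] at h1
      exact h1.trans (le_max_left _ _)
    · have h2 : param R (coords R x 0, coords R x 1) ∈ slab R M := by
        have : ![coords R x 0, coords R x 1] = coords R x := by
          funext i
          fin_cases i <;> rfl
        rw [param, this, chartX_coords hR]
        exact hx
      have h3 := abs_le.mp (abs_le_of_param_mem_slab hR h2)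
      have h4 : coords R x 1 ∈ Ioc (-Real.pi) Real.pi := Complex.arg_mem_Ioc _
      constructor <;> intro i <;> fin_cases i
      · exact h3.1
      · exact h4.1.le
      · exact h3.2
      · exact h4.2
  · simp [hM x hx]

theorem IsSlabBounded.integrable {R : ℝ} (hR : 0 < R) {f : X R → ℂ} {M C : ℝ}
    (hf : IsSlabBounded f M C) : Integrable f (σ R) := by
  have h1 : IntegrableOn f (slab R M) (σ R) :=
    Measure.integrableOn_of_bounded (σ_slab_lt_top hR M).ne hf.measurable.aestronglyMeasurable
      (.of_forall hf.bound)
  refine (integrableOn_iff_integrable_of_support_subset fun x hx => ?_).mp h1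
  by_contra h
  exact hx (hf.eq_zero x h)

theorem IsSlabBounded.mono {R : ℝ} {f : X R → ℂ} {M C M' C' : ℝ} (hf : IsSlabBounded f M C)
    (hM : M ≤ M') (hC : C ≤ C') : IsSlabBounded f M' C' :=
  ⟨hf.measurable, fun x => (hf.bound x).trans hC,
    fun x hx => hf.eq_zero x fun h => hx (le_trans h hM)⟩


/-! ### Factorization of the two-point function -/

/-- The unimodular function `e^{i(η ± θ)}` on `X₂(R)`, where `tan η = sinh t`; the sign `s` is
`1` or `-1`. -/
def mode (R : ℝ) (s : ℤˣ) (x : X R) : ℂ :=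
  (R + x.1 0 * Complex.I) / (x.1 1 - (s : ℤ) * (x.1 2 * Complex.I))

/-- The function `ln (1 - i x⁰ / R)` on `X₂(R)`. -/
def logTime (R : ℝ) (x : X R) : ℂ := Complex.log (1 - (x.1 0 / R : ℝ) * Complex.I)

theorem mem_X_iff {R : ℝ} (x : X R) : x.1 1 ^ 2 + x.1 2 ^ 2 = R ^ 2 + x.1 0 ^ 2 := by
  have h : x.1 0 * x.1 0 - x.1 1 * x.1 1 - x.1 2 * x.1 2 = -R ^ 2 := x.2
  linarith

theorem mode_denom_ne_zero {R : ℝ} (hR : 0 < R) (s : ℤˣ) (x : X R) :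
    (x.1 1 - (s : ℤ) * (x.1 2 * Complex.I) : ℂ) ≠ 0 := by
  intro h
  have h1 := congrArg Complex.re h
  have h2 := congrArg Complex.im h
  have h3 := mem_X_iff x
  rcases Int.units_eq_one_or s with rfl | rfl <;> simp at h1 h2 <;> rw [h1, h2] at h3 <;>
    nlinarith [sq_nonneg (x.1 0)]

theorem continuous_mode {R : ℝ} (hR : 0 < R) (s : ℤˣ) : Continuous (mode R s) := by
  have h (i) : Continuous fun x : X R => (x.1 i : ℂ) :=
    Complex.continuous_ofReal.comp (continuous_coord R i)
  exact (continuous_const.add ((h 0).mul continuous_const)).div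
    ((h 1).sub (continuous_const.mul ((h 2).mul continuous_const))) (mode_denom_ne_zero hR s)

/-- On the hyperboloid `|R + i x⁰|² = R² + (x⁰)² = (x¹)² + (x²)²`. -/
theorem norm_mode {R : ℝ} (hR : 0 < R) (s : ℤˣ) (x : X R) : ‖mode R s x‖ = 1 := by
  rw [mode, norm_div, div_eq_one_iff_eq (norm_ne_zero_iff.mpr (mode_denom_ne_zero hR s x)),
    ← sq_eq_sq₀ (norm_nonneg _) (norm_nonneg _), ← Complex.normSq_eq_norm_sq,
    ← Complex.normSq_eq_norm_sq]
  have h3 := mem_X_iff x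
  rcases Int.units_eq_one_or s with rfl | rfl <;> simp [Complex.normSq_apply] <;> linarith

/-- The prefactor is `e^{iη}` with `tan η = sinh t`, so the mode depends on the null coordinate `η +
sθ` alone. -/
theorem mode_param {R : ℝ} (hR : 0 < R) (s : ℤˣ) (t θ : ℝ) :
    mode R s (param R (t, θ)) =
      (1 + Real.sinh t * Complex.I) / Real.cosh t * Complex.exp ((s : ℤ) * (θ * Complex.I)) := by
  have hd := mode_denom_ne_zero hR s (param R (t, θ))
  have hR' : (R : ℂ) ≠ 0 := by exact_mod_cast hR.ne'
  have hc : (Real.cosh t : ℂ) ≠ 0 := by exact_mod_cast (Real.cosh_pos t).ne'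
  have h2 : Complex.sin θ ^ 2 + Complex.cos θ ^ 2 = 1 := Complex.sin_sq_add_cos_sq θ
  have hI := Complex.I_sq
  rw [mode, div_eq_iff hd]
  have he : Complex.exp ((s : ℤ) * (θ * Complex.I)) =
      Complex.cos θ + (s : ℤ) * (Complex.sin θ * Complex.I) := by
    rcases Int.units_eq_one_or s with rfl | rfl
    · simp [Complex.exp_mul_I]
    · have : ((-1 : ℤˣ) : ℤ) * (θ * Complex.I) = (-θ : ℂ) * Complex.I := by push_cast; ring
      rw [this, Complex.exp_mul_I]
      simp
  rw [he]
  have hs : (((s : ℤˣ) : ℤ) : ℂ) ^ 2 = 1 := by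
    rcases Int.units_eq_one_or s with rfl | rfl <;> simp
  simp only [param, chartX, chart, Matrix.cons_val]
  push_cast at hc ⊢
  field_simp
  generalize Complex.sinh (t : ℂ) = a
  generalize (((s : ℤˣ) : ℤ) : ℂ) = s' at *
  generalize Complex.sin (θ : ℂ) = b at *
  generalize Complex.cos (θ : ℂ) = d at *
  linear_combination (-(1 + a * Complex.I)) * h2 + (1 + a * Complex.I) * s' ^ 2 * b ^ 2 * hI
    - (1 + a * Complex.I) * b ^ 2 * hs

theorem measurable_logTime (R : ℝ) : Measurable (logTime R) := by
  have h : Measurable fun x : X R => 1 - ((x.1 0 / R : ℝ) : ℂ) * Complex.I :=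
    measurable_const.sub ((Complex.measurable_ofReal.comp
      ((continuous_coord R 0).div_const R).measurable).mul_const _)
  exact Complex.measurable_log.comp h

/-- Here `A`, `B` stand for `R ± i x⁰`, and `w`, `v` for `x¹ ± i x²`; the primed letters belong to
the second point, with the same conventions. Then `h` and `h'` are the equations of the hyperboloid,
the four fractions are the modes and their conjugates, and the right-hand side is `-(x - x')²`. -/
theorem mink_factorization_aux {A B w v A' B' w' v' : ℂ} (h : w * v = A * B)
    (h' : w' * v' = A' * B') (hw : w ≠ 0) (hv : v ≠ 0) (hw' : w' ≠ 0) (hv' : v' ≠ 0) :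
    A * B' * (1 - B / w * (A' / v')) * (1 - B / v * (A' / w')) =
      A * B' + B * A' - (w * v' + v * w') := by
  field_simp
  linear_combination (w * v' + v * w' - B * A') * (w' * v' * h + A * B * h')

/-- The interval `(x - x')²` in terms of the modes. -/
theorem mink_factorization {R : ℝ} (hR : 0 < R) (x x' : X R) :
    ((-(mink (x.1 - x'.1) (x.1 - x'.1) / R ^ 2) : ℝ) : ℂ) =
      (1 + (x.1 0 / R : ℝ) * Complex.I) * (1 - (x'.1 0 / R : ℝ) * Complex.I) *
        (1 - conj (mode R 1 x) * mode R 1 x') * (1 - conj (mode R (-1) x) * mode R (-1) x') := by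
  have h1 := mode_denom_ne_zero hR 1 x
  have h2 := mode_denom_ne_zero hR (-1) x
  have h3 := mode_denom_ne_zero hR 1 x'
  have h4 := mode_denom_ne_zero hR (-1) x'
  have hR' : (R : ℂ) ≠ 0 := by exact_mod_cast hR.ne'
  have e : ((x.1 1 : ℂ) ^ 2 + x.1 2 ^ 2 = R ^ 2 + x.1 0 ^ 2) := by exact_mod_cast mem_X_iff x
  have e' : ((x'.1 1 : ℂ) ^ 2 + x'.1 2 ^ 2 = R ^ 2 + x'.1 0 ^ 2) := by
    exact_mod_cast mem_X_iff x'
  have hI := Complex.I_sq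
  simp only [mode, mink, Pi.sub_apply, map_div₀, map_add, map_sub, map_mul, Complex.conj_ofReal,
    Complex.conj_I, Units.val_one, Units.val_neg, Int.cast_one, Int.cast_neg, one_mul, neg_mul,
    sub_neg_eq_add, mul_neg] at *
  push_cast
  generalize (x.1 0 : ℂ) = a at *
  generalize (x.1 1 : ℂ) = b at *
  generalize (x.1 2 : ℂ) = d at *
  generalize (x'.1 0 : ℂ) = a' at *
  generalize (x'.1 1 : ℂ) = b' at *
  generalize (x'.1 2 : ℂ) = d' at *
  generalize (R : ℂ) = r at *
  have key := mink_factorization_aux (A := r + a * Complex.I) (B := r + -(a * Complex.I))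
    (w := b + d * Complex.I) (v := b - d * Complex.I) (A' := r + a' * Complex.I)
    (B' := r - a' * Complex.I) (w' := b' + d' * Complex.I) (v' := b' - d' * Complex.I)
    (by linear_combination e + (a ^ 2 - d ^ 2) * hI)
    (by linear_combination e' + (a' ^ 2 - d' ^ 2) * hI)
    h2 h1 h4 h3
  have hA : 1 + a / r * Complex.I = (r + a * Complex.I) / r := by field_simp
  have hB : 1 - a' / r * Complex.I = (r - a' * Complex.I) / r := by field_simp
  rw [hA, hB]
  simp only [← sub_eq_add_neg] at key ⊢
  have : (r + a * Complex.I) / r * ((r - a' * Complex.I) / r) =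
    (r + a * Complex.I) * (r - a' * Complex.I) / r ^ 2 := by field_simp
  rw [this, div_mul_eq_mul_div, div_mul_eq_mul_div, key, ← neg_div]
  congr 1
  linear_combination (2 * a * a' - 2 * d * d') * hI + e + e'

/-- The regularized two-point function: the modes are damped by the factor `r`. -/
def Wdamped (R c r : ℝ) (x x' : X R) : ℂ :=
  c - 1 / (4 * Real.pi) * (conj (logTime R x) + logTime R x' +
    (Complex.log (1 - r * (conj (mode R 1 x) * mode R 1 x')) +
      Complex.log (1 - r * (conj (mode R (-1) x) * mode R (-1) x'))))

theorem conj_logTime (R : ℝ) (x : X R) :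
    conj (logTime R x) = Complex.log (1 + (x.1 0 / R : ℝ) * Complex.I) := by
  rw [logTime, ← Complex.log_conj]
  · simp
  · intro h
    have := Complex.arg_eq_pi_iff.mp h
    simp at this
    linarith

/-- The only point of the closed unit disc with real part `1` is `1` itself. Off it the principal
logarithm of `1 - w` has imaginary part below `π/2` in modulus. -/
theorem re_one_sub_pos {w : ℂ} (hw : ‖w‖ ≤ 1) (hw1 : w ≠ 1) : 0 < (1 - w).re := by
  rw [Complex.sub_re, Complex.one_re, sub_pos]
  refine lt_of_le_of_ne ((Complex.re_le_norm w).trans hw) fun h => hw1 ?_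
  have h1 : w.re ^ 2 + w.im ^ 2 ≤ 1 := by
    have := Complex.sq_norm w
    rw [Complex.normSq_apply] at this
    nlinarith [norm_nonneg w]
  rw [h] at h1
  have h2 : w.im = 0 := by nlinarith [sq_nonneg w.im]
  exact Complex.ext h h2

/-- A sum of four logarithms in the right half plane, when the product is real. -/
theorem log_add_four {a b p q : ℂ} (ha : 0 < a.re) (hb : 0 < b.re) (hp : 0 < p.re)
    (hq : 0 < q.re) {m : ℝ} (hm : ((-m : ℝ) : ℂ) = a * b * p * q) {s : ℝ}
    (hs : 0 < m → s ≠ 0) (h1 : 0 < s → 0 < (Complex.log a + Complex.log b).im)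
    (h2 : s < 0 → (Complex.log a + Complex.log b).im < 0) :
    Complex.log a + Complex.log b + (Complex.log p + Complex.log q) =
      Real.log |m| + if 0 < m then Complex.I * Real.pi * Real.sign s else 0 := by
  have ne {z : ℂ} (hz : 0 < z.re) : z ≠ 0 := fun h => by simp [h] at hz
  have harg {z : ℂ} (hz : 0 < z.re) : |(Complex.log z).im| < Real.pi / 2 := by
    rw [Complex.log_im]
    exact Complex.abs_arg_lt_pi_div_two_iff.mpr (Or.inl hz)
  set S := Complex.log a + Complex.log b + (Complex.log p + Complex.log q) with hS
  have hexp : Complex.exp S = ((-m : ℝ) : ℂ) := by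
    rw [hS, Complex.exp_add, Complex.exp_add, Complex.exp_add, Complex.exp_log (ne ha),
      Complex.exp_log (ne hb), Complex.exp_log (ne hp), Complex.exp_log (ne hq), hm]
    ring
  have hm0 : m ≠ 0 := by
    rintro rfl
    simp at hexp
  have hre : S.re = Real.log |m| := by
    have := congrArg norm hexp
    rw [Complex.norm_exp, Complex.norm_real, norm_neg, Real.norm_eq_abs] at this
    rw [← this, Real.log_exp]
  have hcos : Real.exp S.re * Real.cos S.im = -m := by
    rw [← Complex.exp_re, hexp, Complex.ofReal_re]
  have hsin : Real.sin S.im = 0 := by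
    have : Real.exp S.re * Real.sin S.im = 0 := by rw [← Complex.exp_im, hexp, Complex.ofReal_im]
    exact (mul_eq_zero.mp this).resolve_left (Real.exp_ne_zero _)
  obtain ⟨n, hn⟩ := Real.sin_eq_zero_iff.mp hsin
  have him : S.im = (Complex.log a + Complex.log b).im +
      ((Complex.log p).im + (Complex.log q).im) := by
    simp [hS]
  have hab : (Complex.log a + Complex.log b).im = (Complex.log a).im + (Complex.log b).im := by simp
  obtain ⟨a1, a2⟩ := abs_lt.mp (harg ha)
  obtain ⟨b1, b2⟩ := abs_lt.mp (harg hb)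
  obtain ⟨p1, p2⟩ := abs_lt.mp (harg hp)
  obtain ⟨q1, q2⟩ := abs_lt.mp (harg hq)
  have hpi := Real.pi_pos
  -- The product is real, so `Im S = nπ`; four arguments, each below `π/2` in modulus, leave `n` in
  -- `{-1, 0, 1}`.
  have hn1 : n < 2 := by
    have : (n : ℝ) < 2 := by
      by_contra! h
      nlinarith
    exact_mod_cast this
  have hn2 : -2 < n := by
    have : (-2 : ℝ) < n := by
      by_contra! h
      nlinarith
    exact_mod_cast this
  have hE := Real.exp_pos S.re
  apply Complex.ext
  · rw [hre]
    split_ifs <;> simp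
  · have himR : (((Real.log |m| : ℝ) : ℂ) +
        if 0 < m then Complex.I * Real.pi * Real.sign s else 0).im =
        if 0 < m then Real.pi * Real.sign s else 0 := by
      split_ifs <;> simp
    rw [himR]
    -- The sign of `-m = e^{Re S} cos (nπ)` decides between `n = 0` and `n = ±1`. In the latter case
    -- `log p + log q` contributes less than `π` in modulus to `Im S`, so the sign of `n` is that of
    -- `Im (log a + log b)`.
    split_ifs with h
    · rcases lt_or_gt_of_ne (hs h) with h0 | h0
      · have := h2 h0
        have : n = -1 := by
          interval_cases n
          · rfl
          · simp at hn
            rw [← hn] at hcos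
            simp at hcos
            linarith
          · push_cast at hn
            linarith
        rw [Real.sign_of_neg h0, ← hn, this]
        push_cast
        ring
      · have := h1 h0
        have : n = 1 := by
          interval_cases n
          · push_cast at hn
            linarith
          · simp at hn
            rw [← hn] at hcos
            simp at hcos
            linarith
          · rfl
        rw [Real.sign_of_pos h0, ← hn, this]
        push_cast
        ring
    · have h : m < 0 := lt_of_le_of_ne (not_lt.mp h) hm0
      have : n = 0 := by
        interval_cases n
        · push_cast at hn
          rw [← hn] at hcos
          simp at hcos
          linarith
        · rfl
        · push_cast at hn
          rw [← hn] at hcos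
          simp at hcos
          linarith
      rw [← hn, this]
      simp

theorem re_one_add_mul_I (a : ℝ) : (1 + (a : ℂ) * Complex.I).re = 1 := by simp

theorem re_one_sub_mul_I (a : ℝ) : (1 - (a : ℂ) * Complex.I).re = 1 := by simp

theorem im_log_one_add_mul_I (a : ℝ) :
    (Complex.log (1 + (a : ℂ) * Complex.I)).im = Real.arctan a := by
  rw [Complex.log_im, Complex.arg_of_re_nonneg (by simp), Real.arctan_eq_arcsin]
  congr 1
  rw [Complex.norm_eq_sqrt_sq_add_sq]
  simp

/-- Off the light cone, the two-point function is a sum of logarithms of modes. -/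
theorem W_eq_Wdamped {R : ℝ} (hR : 0 < R) (c : ℝ) {x x' : X R}
    (h1 : conj (mode R 1 x) * mode R 1 x' ≠ 1)
    (h2 : conj (mode R (-1) x) * mode R (-1) x' ≠ 1) :
    W R c x.1 x'.1 = Wdamped R c 1 x x' := by
  have hn (s) : ‖conj (mode R s x) * mode R s x'‖ ≤ 1 := by
    rw [norm_mul, Complex.norm_conj, norm_mode hR, norm_mode hR, one_mul]
  rw [W, Wdamped, conj_logTime, logTime, Complex.ofReal_one, one_mul, one_mul]
  have hb : (1 - ((x'.1 0 / R : ℝ) : ℂ) * Complex.I) =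
      (1 + ((-(x'.1 0 / R) : ℝ) : ℂ) * Complex.I) := by
    push_cast
    ring
  -- As `arctan` is increasing, this difference has the sign of `x⁰ - x'⁰`, which fixes the branch.
  have him : (Complex.log (1 + ((x.1 0 / R : ℝ) : ℂ) * Complex.I) +
      Complex.log (1 - ((x'.1 0 / R : ℝ) : ℂ) * Complex.I)).im =
      Real.arctan (x.1 0 / R) - Real.arctan (x'.1 0 / R) := by
    rw [hb, Complex.add_im, im_log_one_add_mul_I, im_log_one_add_mul_I, Real.arctan_neg]
    ring
  rw [log_add_four (m := mink (x.1 - x'.1) (x.1 - x'.1) / R ^ 2) (s := x.1 0 - x'.1 0)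
    (by rw [re_one_add_mul_I]; exact one_pos) (by rw [re_one_sub_mul_I]; exact one_pos)
    (re_one_sub_pos (hn 1) h1) (re_one_sub_pos (hn (-1)) h2) (mink_factorization hR x x')]
  · have : 0 < mink (x.1 - x'.1) (x.1 - x'.1) / R ^ 2 ↔ 0 < mink (x.1 - x'.1) (x.1 - x'.1) :=
      div_pos_iff_of_pos_right (by positivity)
    simp only [this]
  · intro h h0
    have h' := (div_pos_iff_of_pos_right (by positivity : 0 < R ^ 2)).mp h
    simp only [mink, Pi.sub_apply, h0] at h'
    nlinarith [sq_nonneg (x.1 1 - x'.1 1), sq_nonneg (x.1 2 - x'.1 2)]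
  · intro h
    rw [him, sub_pos, Real.arctan_lt_arctan_iff]
    gcongr
    linarith
  · intro h
    rw [him, sub_neg, Real.arctan_lt_arctan_iff]
    gcongr
    linarith


/-! ### Integrability of the two-point function -/

theorem norm_one_sub_exp_units_mul (s : ℤˣ) (θ : ℝ) :
    ‖1 - Complex.exp ((s : ℤ) * (θ * Complex.I))‖ = ‖1 - Complex.exp (θ * Complex.I)‖ := by
  rcases Int.units_eq_one_or s with rfl | rfl
  · simp
  · rw [← Complex.norm_conj (1 - Complex.exp (θ * Complex.I)), map_sub, map_one,
      ← Complex.exp_conj]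
    simp

/-- The singularity at `θ = 0` is logarithmic: `z ↦ 1 - z` is meromorphic on the unit circle, hence
the logarithm of its norm is circle integrable. -/
theorem intervalIntegrable_log_norm_one_sub_exp :
    IntervalIntegrable (fun θ : ℝ => Real.log ‖1 - Complex.exp (θ * Complex.I)‖) volume
      0 (2 * Real.pi) := by
  have h : MeromorphicOn (fun z : ℂ => 1 - z) (Metric.sphere 0 |1|) :=
    (analyticOnNhd_const.sub analyticOnNhd_id).meromorphicOn
  have := h.circleIntegrable_log_norm
  simpa [CircleIntegrable, circleMap] using this

/-- The function `ln |1 - e^{i(φ ± θ)}|` has an integral bounded independently of the phase. -/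
theorem exists_lintegral_log_norm_le : ∃ C : ℝ≥0∞, C < ⊤ ∧ ∀ (s : ℤˣ) (z : ℂ), ‖z‖ = 1 →
    ∫⁻ θ in angles, ‖Real.log ‖1 - z * Complex.exp ((s : ℤ) * (θ * Complex.I))‖‖ₑ ≤ C := by
  set k : ℝ → ℝ := fun θ => Real.log ‖1 - Complex.exp (θ * Complex.I)‖ with hk
  have hper : Function.Periodic k (2 * Real.pi) := by
    intro θ
    have : ((θ + 2 * Real.pi : ℝ) : ℂ) * Complex.I = θ * Complex.I + 2 * Real.pi * Complex.I := by
      push_cast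
      ring
    simp only [hk, this, Complex.exp_add, Complex.exp_two_pi_mul_I, mul_one]
  have hint : ∀ a b, IntervalIntegrable k volume a b := fun a b =>
    hper.intervalIntegrable₀ Real.two_pi_pos.ne' intervalIntegrable_log_norm_one_sub_exp a b
  refine ⟨ENNReal.ofReal (∫ θ in (0 : ℝ)..0 + 2 * Real.pi, ‖k θ‖), ENNReal.ofReal_lt_top, ?_⟩
  intro s z hz
  have hz' : z = Complex.exp (Complex.arg z * Complex.I) := by
    conv_lhs => rw [← Complex.norm_mul_exp_arg_mul_I z, hz]
    simp
  -- As `s² = 1`, the phase of `z` is a shift of the angle by `s * arg z`; the sign `s` then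
  -- disappears from the norm by conjugation. By periodicity the integral over a period does not see
  -- the shift.
  set a : ℝ := (s : ℤ) * Complex.arg z with ha
  have hs : (((s : ℤˣ) : ℤ) : ℂ) * (((s : ℤˣ) : ℤ) : ℂ) = 1 := by
    rcases Int.units_eq_one_or s with rfl | rfl <;> simp
  have heq : ∀ θ : ℝ, Real.log ‖1 - z * Complex.exp ((s : ℤ) * (θ * Complex.I))‖ = k (θ + a) := by
    intro θ
    have : z * Complex.exp ((s : ℤ) * (θ * Complex.I)) =
        Complex.exp ((s : ℤ) * ((θ + a : ℝ) * Complex.I)) := by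
      conv_lhs => rw [hz', ← Complex.exp_add]
      congr 1
      rw [ha]
      push_cast
      linear_combination (-(Complex.arg z * Complex.I)) * hs
    rw [this, norm_one_sub_exp_units_mul]
  simp only [heq]
  have hi : IntervalIntegrable (fun θ => k (θ + a)) volume (-Real.pi) Real.pi := by
    have := (hint (-Real.pi + a) (Real.pi + a)).comp_add_right a
    simpa using this
  have hle : -Real.pi ≤ Real.pi := by linarith [Real.pi_pos]
  rw [← ofReal_integral_norm_eq_lintegral_enorm
    ((intervalIntegrable_iff_integrableOn_Ioc_of_le hle).mp hi),
    ← intervalIntegral.integral_of_le hle,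
    intervalIntegral.integral_comp_add_right (fun θ => ‖k θ‖)]
  have hper' : Function.Periodic (fun θ => ‖k θ‖) (2 * Real.pi) := fun θ => by
    simp only [hper θ]
  have := hper'.intervalIntegral_add_eq (-Real.pi + a) 0
  rw [← this]
  apply le_of_eq
  congr 2
  ring

theorem norm_phase (t : ℝ) : ‖(1 + Real.sinh t * Complex.I) / (Real.cosh t : ℂ)‖ = 1 := by
  have hc := Real.cosh_pos t
  have h : Real.cosh t = √(1 + Real.sinh t ^ 2) := by
    rw [← Real.cosh_sq', Real.sqrt_sq hc.le]
  rw [norm_div, Complex.norm_real, Real.norm_of_nonneg hc.le, div_eq_one_iff_eq hc.ne',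
    Complex.norm_eq_sqrt_sq_add_sq]
  simpa [-Complex.ofReal_sinh] using h.symm

/-- The kernel `e^{i(u' - u)}`, where `u = η ± θ`. -/
def modeKernel (R : ℝ) (s : ℤˣ) (p : X R × X R) : ℂ := conj (mode R s p.1) * mode R s p.2

theorem continuous_modeKernel {R : ℝ} (hR : 0 < R) (s : ℤˣ) : Continuous (modeKernel R s) :=
  (Complex.continuous_conj.comp ((continuous_mode hR s).comp continuous_fst)).mul
    ((continuous_mode hR s).comp continuous_snd)

theorem norm_modeKernel {R : ℝ} (hR : 0 < R) (s : ℤˣ) (p : X R × X R) :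
    ‖modeKernel R s p‖ = 1 := by
  rw [modeKernel, norm_mul, Complex.norm_conj, norm_mode hR, norm_mode hR, one_mul]

theorem measurable_log_norm_modeKernel {R : ℝ} (hR : 0 < R) (s : ℤˣ) :
    Measurable fun p : X R × X R => Real.log ‖1 - modeKernel R s p‖ :=
  Real.measurable_log.comp (continuous_const.sub (continuous_modeKernel hR s)).norm.measurable

/-- Tonelli: for a fixed first point and a fixed time of the second, the kernel is a unimodular
constant times `e^{isθ}`, so the angular integral has the uniform bound of
`exists_lintegral_log_norm_le`. What remains is the finite volume of slabs. -/
theorem integrableOn_log_norm_modeKernel {R : ℝ} (hR : 0 < R) (s : ℤˣ) (M : ℝ) :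
    IntegrableOn (fun p : X R × X R => Real.log ‖1 - modeKernel R s p‖)
      (slab R M ×ˢ slab R M) ((σ R).prod (σ R)) := by
  have hm := measurable_log_norm_modeKernel hR s
  refine ⟨hm.aestronglyMeasurable, ?_⟩
  obtain ⟨C, hC, hb⟩ := exists_lintegral_log_norm_le
  rw [hasFiniteIntegral_iff_enorm, ← Measure.prod_restrict, lintegral_prod _ hm.enorm.aemeasurable]
  have hbound : ∀ x : X R, ∫⁻ x' in slab R M, ‖Real.log ‖1 - modeKernel R s (x, x')‖‖ₑ ∂σ R ≤
      (∫⁻ t in Icc (-(M / R)) (M / R), ENNReal.ofReal (R ^ 2 * Real.cosh t)) * C := by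
    intro x
    refine setLIntegral_slab_le hR M (hm.enorm.comp measurable_prodMk_left) C fun t => ?_
    refine le_trans (le_of_eq ?_) (hb s
      (conj (mode R s x) * ((1 + Real.sinh t * Complex.I) / (Real.cosh t : ℂ))) ?_)
    · refine lintegral_congr fun θ => ?_
      simp only [Function.comp_apply, modeKernel, mode_param hR, mul_assoc]
    · rw [norm_mul, Complex.norm_conj, norm_mode hR, norm_phase, one_mul]
  refine (lintegral_mono hbound).trans_lt ?_
  rw [lintegral_const, Measure.restrict_apply_univ]
  exact ENNReal.mul_lt_top (ENNReal.mul_lt_top (lintegral_cosh_lt_top _ _) hC) (σ_slab_lt_top hR M)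

/-! ### The light cone as a null set -/

theorem countable_exp_eq (s : ℤˣ) (w : ℂ) :
    {θ : ℝ | Complex.exp ((s : ℤ) * (θ * Complex.I)) = w}.Countable := by
  rcases eq_empty_or_nonempty {θ : ℝ | Complex.exp ((s : ℤ) * (θ * Complex.I)) = w} with h | ⟨θ₀, h₀⟩
  · rw [h]
    exact countable_empty
  · refine (countable_range fun n : ℤ => θ₀ + (s : ℤ) * (n * (2 * Real.pi))).mono fun θ hθ => ?_
    have h : Complex.exp ((s : ℤ) * (θ * Complex.I)) = Complex.exp ((s : ℤ) * (θ₀ * Complex.I)) :=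
      Eq.trans hθ h₀.symm
    obtain ⟨n, hn⟩ := Complex.exp_eq_exp_iff_exists_int.mp h
    refine ⟨n, ?_⟩
    have hs : (((s : ℤˣ) : ℤ) : ℂ) * (((s : ℤˣ) : ℤ) : ℂ) = 1 := by
      rcases Int.units_eq_one_or s with rfl | rfl <;> simp
    have h1 : ((θ : ℂ) - (θ₀ + (s : ℤ) * (n * (2 * Real.pi)))) * Complex.I = 0 := by
      linear_combination ((s : ℤ) : ℂ) * hn + (θ₀ - θ) * Complex.I * hs
    have h2 := (mul_eq_zero.mp h1).resolve_right Complex.I_ne_zero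
    have h3 : ((θ - (θ₀ + (s : ℤ) * (n * (2 * Real.pi))) : ℝ) : ℂ) = 0 := by
      push_cast
      exact h2
    have h4 := Complex.ofReal_eq_zero.mp h3
    simp only
    linarith

/-- By `mink_factorization` the exceptional sets for `s = ±1` together form the light cone `(x -
x')² = 0`. For a fixed first point and a fixed time of the second, only countably many angles lie in
each. -/
theorem ae_modeKernel_ne_one {R : ℝ} (hR : 0 < R) (s : ℤˣ) :
    ∀ᵐ p ∂((σ R).prod (σ R)), modeKernel R s p ≠ 1 := by
  have hms : MeasurableSet {p : X R × X R | ¬ modeKernel R s p ≠ 1} := by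
    simp only [not_not]
    exact (continuous_modeKernel hR s).measurable (measurableSet_singleton 1)
  rw [ae_iff, Measure.measure_prod_null hms]
  refine .of_forall fun x => ?_
  have hmx : MeasurableSet (Prod.mk x ⁻¹' {p : X R × X R | ¬ modeKernel R s p ≠ 1}) :=
    measurable_prodMk_left hms
  simp only [Pi.zero_apply]
  rw [← lintegral_indicator_one hmx, lintegral_σ R (measurable_one.indicator hmx)]
  have h0 : ∀ t, ∫⁻ θ in angles, (Prod.mk x ⁻¹' {p : X R × X R | ¬ modeKernel R s p ≠ 1}).indicator
      (1 : X R → ℝ≥0∞) (param R (t, θ)) = 0 := by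
    intro t
    have hc := (countable_exp_eq s
      (conj (mode R s x) * ((1 + Real.sinh t * Complex.I) / (Real.cosh t : ℂ)))⁻¹).ae_notMem
        (volume.restrict angles)
    rw [lintegral_eq_zero_iff' ?_]
    · filter_upwards [hc] with θ hθ
      refine indicator_of_notMem (fun hmem => hθ ?_) _
      have h1 : conj (mode R s x) * mode R s (param R (t, θ)) = 1 := by
        simpa [modeKernel] using hmem
      rw [mode_param hR, ← mul_assoc] at h1
      exact (eq_inv_of_mul_eq_one_right h1)
    · exact ((measurable_one.indicator hmx).comp
        ((continuous_param R).measurable.comp measurable_prodMk_left)).aemeasurable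
  simp only [h0, mul_zero, lintegral_zero]

/-- From `|1 - w| ≤ |1 - rw| + (1 - r)` and `1 - r ≤ |1 - rw|` one gets `|1 - w|/2 ≤ |1 - rw| ≤ 2`.
The bound does not depend on `r`, as dominated convergence for `r → 1` requires. -/
theorem abs_log_norm_one_sub_le {w : ℂ} (hw : ‖w‖ = 1) (hw1 : w ≠ 1) {r : ℝ} (h0 : 0 ≤ r)
    (h1 : r ≤ 1) : |Real.log ‖1 - r * w‖| ≤ |Real.log ‖1 - w‖| + Real.log 2 := by
  have hpos : 0 < ‖1 - w‖ := norm_pos_iff.mpr (sub_ne_zero.mpr (Ne.symm hw1))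
  have hrw : ‖(r : ℂ) * w‖ = r := by rw [norm_mul, hw, mul_one, Complex.norm_of_nonneg h0]
  have hup : ‖1 - r * w‖ ≤ 2 := by
    refine (norm_sub_le _ _).trans ?_
    rw [hrw, norm_one]
    linarith
  have hlow : ‖1 - w‖ / 2 ≤ ‖1 - r * w‖ := by
    have e1 : ‖1 - w‖ ≤ ‖1 - r * w‖ + (1 - r) := by
      have : 1 - w = (1 - r * w) - ((1 - r : ℝ) : ℂ) * w := by
        push_cast
        ring
      rw [this]
      refine (norm_sub_le _ _).trans ?_
      rw [norm_mul, hw, mul_one, Complex.norm_of_nonneg (by linarith)]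
    have e2 : 1 - r ≤ ‖1 - r * w‖ := by
      have := norm_sub_norm_le 1 (r * w)
      rwa [hrw, norm_one] at this
    linarith
  have hp' : 0 < ‖1 - r * w‖ := by linarith [half_pos hpos]
  rw [abs_le]
  constructor
  · have := Real.log_le_log (half_pos hpos) hlow
    rw [Real.log_div hpos.ne' two_ne_zero] at this
    linarith [neg_abs_le (Real.log ‖1 - w‖)]
  · have := Real.log_le_log hp' hup
    linarith [abs_nonneg (Real.log ‖1 - w‖)]

theorem norm_log_le (z : ℂ) : ‖Complex.log z‖ ≤ |Real.log ‖z‖| + Real.pi := by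
  refine (Complex.norm_le_abs_re_add_abs_im _).trans ?_
  rw [Complex.log_re, Complex.log_im]
  gcongr
  exact Complex.abs_arg_le_pi z

theorem norm_logTime_le {R : ℝ} (hR : 0 < R) {M : ℝ} {x : X R} (hx : x ∈ slab R M) :
    ‖logTime R x‖ ≤ M / R + Real.pi := by
  refine (norm_log_le _).trans (add_le_add_left ?_ _)
  set z : ℂ := 1 - (x.1 0 / R : ℝ) * Complex.I
  have h1 : 1 ≤ ‖z‖ := by
    have := Complex.re_le_norm z
    rwa [re_one_sub_mul_I] at this
  have h2 : ‖z‖ ≤ 1 + M / R := by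
    refine (norm_sub_le _ _).trans ?_
    rw [norm_one, norm_mul, Complex.norm_I, mul_one, Complex.norm_real, Real.norm_eq_abs, abs_div,
      abs_of_pos hR]
    gcongr
    exact hx
  rw [abs_of_nonneg (Real.log_nonneg h1)]
  linarith [Real.log_le_sub_one_of_pos (by linarith : 0 < ‖z‖)]

/-- An integrable majorant, on a slab, of the damped two-point functions. -/
def majorant (R c M : ℝ) (p : X R × X R) : ℝ :=
  (|c| + (2 * (M / R) + 4 * Real.pi + 2 * Real.log 2)) +
    (|Real.log ‖1 - modeKernel R 1 p‖| + |Real.log ‖1 - modeKernel R (-1) p‖|)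

theorem integrableOn_majorant {R : ℝ} (hR : 0 < R) (c M : ℝ) :
    IntegrableOn (majorant R c M) (slab R M ×ˢ slab R M) ((σ R).prod (σ R)) := by
  refine Integrable.add ?_ ((integrableOn_log_norm_modeKernel hR 1 M).abs.add
    (integrableOn_log_norm_modeKernel hR (-1) M).abs)
  refine integrableOn_const ?_
  rw [Measure.prod_prod]
  exact (ENNReal.mul_lt_top (σ_slab_lt_top hR M) (σ_slab_lt_top hR M)).ne

theorem norm_Wdamped_le {R : ℝ} (hR : 0 < R) (c : ℝ) {M r : ℝ} (h0 : 0 ≤ r) (h1 : r ≤ 1)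
    {p : X R × X R} (hp : p ∈ slab R M ×ˢ slab R M) (hp1 : modeKernel R 1 p ≠ 1)
    (hp2 : modeKernel R (-1) p ≠ 1) : ‖Wdamped R c r p.1 p.2‖ ≤ majorant R c M p := by
  have hk (s) (hs : modeKernel R s p ≠ 1) :
      ‖Complex.log (1 - r * (conj (mode R s p.1) * mode R s p.2))‖ ≤
        |Real.log ‖1 - modeKernel R s p‖| + Real.log 2 + Real.pi :=
    (norm_log_le _).trans (add_le_add_left
      (abs_log_norm_one_sub_le (norm_modeKernel hR s p) hs h0 h1) _)
  have ha : ‖conj (logTime R p.1)‖ ≤ M / R + Real.pi := by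
    rw [Complex.norm_conj]
    exact norm_logTime_le hR hp.1
  have hb := norm_logTime_le hR hp.2
  have hcoef : ‖(1 / (4 * Real.pi) : ℂ)‖ ≤ 1 := by
    have : (1 / (4 * Real.pi) : ℂ) = ((1 / (4 * Real.pi) : ℝ) : ℂ) := by push_cast; ring
    rw [this, Complex.norm_of_nonneg (by positivity), div_le_one (by positivity)]
    linarith [Real.pi_gt_three]
  have hsum := norm_add_le (conj (logTime R p.1) + logTime R p.2)
    (Complex.log (1 - r * (conj (mode R 1 p.1) * mode R 1 p.2)) +
      Complex.log (1 - r * (conj (mode R (-1) p.1) * mode R (-1) p.2)))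
  rw [Wdamped]
  refine (norm_sub_le _ _).trans ?_
  rw [Complex.norm_real, Real.norm_eq_abs, norm_mul, majorant]
  have := mul_le_of_le_one_left (norm_nonneg (conj (logTime R p.1) + logTime R p.2 +
    (Complex.log (1 - r * (conj (mode R 1 p.1) * mode R 1 p.2)) +
      Complex.log (1 - r * (conj (mode R (-1) p.1) * mode R (-1) p.2))))) hcoef
  -- Two terms `M/R + π` from `logTime` and two terms `log 2 + π` from the kernels add up to the
  -- constant in `majorant`; the prefactor `1/(4π)` is merely bounded by `1`.
  linarith [norm_add_le (conj (logTime R p.1)) (logTime R p.2), hk 1 hp1, hk (-1) hp2,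
    norm_add_le (Complex.log (1 - r * (conj (mode R 1 p.1) * mode R 1 p.2)))
      (Complex.log (1 - r * (conj (mode R (-1) p.1) * mode R (-1) p.2)))]

theorem measurable_Wdamped {R : ℝ} (hR : 0 < R) (c r : ℝ) :
    Measurable fun p : X R × X R => Wdamped R c r p.1 p.2 := by
  have hl := measurable_logTime R
  have hk (s) : Measurable fun p : X R × X R =>
      Complex.log (1 - r * (conj (mode R s p.1) * mode R s p.2)) :=
    Complex.measurable_log.comp
      (continuous_const.sub (continuous_const.mul (continuous_modeKernel hR s))).measurable
  exact measurable_const.sub (measurable_const.mul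
    (((Complex.continuous_conj.measurable.comp (hl.comp measurable_fst)).add
      (hl.comp measurable_snd)).add ((hk 1).add (hk (-1)))))

/-! ### Local integrability of the two-point function -/

theorem ae_W_eq {R : ℝ} (hR : 0 < R) (c : ℝ) :
    (fun p : X R × X R => W R c p.1 p.2) =ᵐ[(σ R).prod (σ R)] fun p => Wdamped R c 1 p.1 p.2 := by
  filter_upwards [ae_modeKernel_ne_one hR 1, ae_modeKernel_ne_one hR (-1)] with p h1 h2
  exact W_eq_Wdamped hR c h1 h2

theorem integrableOn_W {R : ℝ} (hR : 0 < R) (c M : ℝ) :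
    IntegrableOn (fun p : X R × X R => W R c p.1 p.2) (slab R M ×ˢ slab R M)
      ((σ R).prod (σ R)) := by
  have hS := (measurableSet_slab R M).prod (measurableSet_slab R M)
  refine IntegrableOn.congr_fun_ae ?_ (ae_restrict_of_ae (ae_W_eq hR c).symm)
  refine (integrableOn_majorant hR c M).mono' (measurable_Wdamped hR c 1).aestronglyMeasurable ?_
  filter_upwards [ae_restrict_of_ae (ae_modeKernel_ne_one hR 1),
    ae_restrict_of_ae (ae_modeKernel_ne_one hR (-1)), ae_restrict_mem hS] with p h1 h2 h3
  exact norm_Wdamped_le hR c zero_le_one le_rfl h3 h1 h2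

theorem locallyIntegrable_W {R : ℝ} (hR : 0 < R) (c : ℝ) :
    LocallyIntegrable (fun p : X R × X R => W R c p.1 p.2) ((σ R).prod (σ R)) := by
  intro p
  set M := |p.1.1 0| + |p.2.1 0| + 1
  refine ⟨slab R M ×ˢ slab R M, ?_, integrableOn_W hR c M⟩
  have h (x : X R) (hx : |x.1 0| < M) : slab R M ∈ 𝓝 x := by
    filter_upwards [(isOpen_lt (continuous_coord R 0).abs continuous_const).mem_nhds hx] with y hy
    exact le_of_lt hy
  refine prod_mem_nhds (h _ ?_) (h _ ?_)
  · linarith [abs_nonneg (p.2.1 0)]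
  · linarith [abs_nonneg (p.1.1 0)]

theorem IsSlabBounded.integrable_kernel {R : ℝ} {f g : X R → ℂ} {M C C' : ℝ}
    (hf : IsSlabBounded f M C) (hg : IsSlabBounded g M C') {K : X R × X R → ℂ}
    (hK : IntegrableOn K (slab R M ×ˢ slab R M) ((σ R).prod (σ R))) :
    Integrable (fun p => K p * conj (f p.1) * g p.2) ((σ R).prod (σ R)) := by
  have hm : Measurable fun p : X R × X R => conj (f p.1) * g p.2 :=
    (Complex.continuous_conj.measurable.comp (hf.measurable.comp measurable_fst)).mul
      (hg.measurable.comp measurable_snd)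
  have h : IntegrableOn (fun p => K p * conj (f p.1) * g p.2) (slab R M ×ˢ slab R M)
      ((σ R).prod (σ R)) := by
    simp only [mul_assoc]
    refine Integrable.mul_bdd (c := C * C') hK hm.aestronglyMeasurable (.of_forall fun p => ?_)
    rw [norm_mul, Complex.norm_conj]
    exact mul_le_mul (hf.bound _) (hg.bound _) (norm_nonneg _)
      ((norm_nonneg _).trans (hf.bound p.1))
  refine (integrableOn_iff_integrable_of_support_subset fun p hp => ?_).mp h
  by_contra hn
  apply hp
  simp only [mem_prod, not_and_or] at hn
  rcases hn with hn | hn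
  · simp [hf.eq_zero _ hn]
  · simp [hg.eq_zero _ hn]


/-! ### Mode expansion of the form -/

/-- The mode coefficient `∫ e^{i(n+1)(η ± θ)} f dσ`. -/
def modeCoeff {R : ℝ} (s : ℤˣ) (n : ℕ) (f : X R → ℂ) : ℂ := ∫ x, mode R s x ^ (n + 1) * f x ∂σ R

/-- The contribution of the modes of sign `s` to the damped form. -/
def modeForm {R : ℝ} (r : ℝ) (s : ℤˣ) (f g : X R → ℂ) : ℂ :=
  ∫ p : X R × X R, -Complex.log (1 - r * modeKernel R s p) * conj (f p.1) * g p.2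
    ∂((σ R).prod (σ R))

theorem integral_conj_mul_prod {R : ℝ} (f g : X R → ℂ) :
    ∫ p : X R × X R, conj (f p.1) * g p.2 ∂((σ R).prod (σ R)) =
      conj (∫ x, f x ∂σ R) * ∫ x, g x ∂σ R := by
  rw [integral_prod_mul (fun x => conj (f x)) g, integral_conj]

theorem integrable_conj_mul_prod {R : ℝ} {f g : X R → ℂ} (hf : Integrable f (σ R))
    (hg : Integrable g (σ R)) :
    Integrable (fun p : X R × X R => conj (f p.1) * g p.2) ((σ R).prod (σ R)) :=
  Integrable.mul_prod (f := fun x => conj (f x))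
    ((Complex.conjLIE.integrable_comp_iff).mpr hf) hg

theorem IsSlabBounded.mul_left {R : ℝ} {f : X R → ℂ} {M C C' : ℝ} (hf : IsSlabBounded f M C)
    {k : X R → ℂ} (hk : Measurable k) (hb : ∀ x ∈ slab R M, ‖k x‖ ≤ C') :
    IsSlabBounded (fun x => k x * f x) M (|C'| * |C|) where
  measurable := hk.mul hf.measurable
  bound x := by
    by_cases hx : x ∈ slab R M
    · rw [norm_mul]
      exact mul_le_mul ((hb x hx).trans (le_abs_self _)) ((hf.bound x).trans (le_abs_self _))
        (norm_nonneg _) (abs_nonneg _)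
    · rw [hf.eq_zero x hx, mul_zero, norm_zero]
      positivity
  eq_zero x hx := by rw [hf.eq_zero x hx, mul_zero]

/-- In the series `∑ zⁿ/n` of `-log (1 - z)` at `z = r * conj (m x) * m x'` each term is a product
over the two points. The geometric decay from `r < 1` permits integration term by term. For `f = g`
every term is nonnegative. -/
theorem hasSum_modeForm {R : ℝ} (hR : 0 < R) (s : ℤˣ) {r : ℝ} (h0 : 0 ≤ r) (h1 : r < 1)
    {f g : X R → ℂ} {M C M' C' : ℝ} (hf : IsSlabBounded f M C) (hg : IsSlabBounded g M' C') :
    HasSum (fun n : ℕ => ((r ^ (n + 1) / (n + 1) : ℝ) : ℂ) *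
      (conj (modeCoeff s n f) * modeCoeff s n g)) (modeForm r s f g) := by
  have hpow (n : ℕ) : Measurable fun x => mode R s x ^ (n + 1) :=
    ((continuous_mode hR s).pow _).measurable
  have hpn (n : ℕ) (x : X R) : ‖mode R s x ^ (n + 1)‖ = 1 := by
    rw [norm_pow, norm_mode hR, one_pow]
  set F : ℕ → X R × X R → ℂ := fun n p => ((r ^ (n + 1) / (n + 1) : ℝ) : ℂ) *
    (conj (mode R s p.1 ^ (n + 1) * f p.1) * (mode R s p.2 ^ (n + 1) * g p.2)) with hF
  have hint (n : ℕ) : Integrable (F n) ((σ R).prod (σ R)) :=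
    (integrable_conj_mul_prod
      ((hf.mul_left (hpow n) fun x _ => (hpn n x).le).integrable hR)
      ((hg.mul_left (hpow n) fun x _ => (hpn n x).le).integrable hR)).const_mul _
  have hnorm (n : ℕ) (p : X R × X R) : ‖F n p‖ = r ^ (n + 1) / (n + 1) * (‖f p.1‖ * ‖g p.2‖) := by
    simp only [hF, norm_mul, Complex.norm_conj, hpn, one_mul]
    rw [Complex.norm_of_nonneg (by positivity)]
  have hsum : Summable fun n => ∫ p, ‖F n p‖ ∂((σ R).prod (σ R)) := by
    simp only [hnorm, integral_const_mul]
    refine Summable.mul_right _ ?_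
    refine Summable.of_nonneg_of_le (fun n => by positivity) (fun n => ?_)
      ((summable_nat_add_iff 1).mpr (summable_geometric_of_lt_one h0 h1))
    exact div_le_self (by positivity) (by linarith [n.cast_nonneg (α := ℝ)])
  have key := hasSum_integral_of_summable_integral_norm hint hsum
  have e1 (n : ℕ) : ∫ p, F n p ∂((σ R).prod (σ R)) = ((r ^ (n + 1) / (n + 1) : ℝ) : ℂ) *
      (conj (modeCoeff s n f) * modeCoeff s n g) := by
    simp only [hF, integral_const_mul]
    rw [integral_conj_mul_prod (fun x => mode R s x ^ (n + 1) * f x)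
      (fun x => mode R s x ^ (n + 1) * g x)]
    rfl
  have e2 (p : X R × X R) : ∑' n, F n p =
      -Complex.log (1 - r * modeKernel R s p) * conj (f p.1) * g p.2 := by
    have hz : ‖(r : ℂ) * modeKernel R s p‖ < 1 := by
      rwa [norm_mul, norm_modeKernel hR, mul_one, Complex.norm_of_nonneg h0]
    have := ((Complex.hasSum_taylorSeries_neg_log' hz).mul_right (conj (f p.1))).mul_right (g p.2)
    rw [← this.tsum_eq]
    refine tsum_congr fun n => ?_
    simp only [hF, modeKernel, map_mul, map_pow]
    push_cast
    ring
  simp only [e1, e2] at key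
  exact key

theorem integrableOn_log_modeKernel {R : ℝ} (hR : 0 < R) (s : ℤˣ) {r : ℝ} (h0 : 0 ≤ r)
    (h1 : r ≤ 1) (M : ℝ) :
    IntegrableOn (fun p : X R × X R => Complex.log (1 - r * modeKernel R s p))
      (slab R M ×ˢ slab R M) ((σ R).prod (σ R)) := by
  have hc : IntegrableOn (fun _ : X R × X R => Real.log 2 + Real.pi) (slab R M ×ˢ slab R M)
      ((σ R).prod (σ R)) := by
    refine integrableOn_const ?_
    rw [Measure.prod_prod]
    exact (ENNReal.mul_lt_top (σ_slab_lt_top hR M) (σ_slab_lt_top hR M)).ne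
  refine Integrable.mono' ((integrableOn_log_norm_modeKernel hR s M).abs.add hc)
    (Complex.measurable_log.comp (continuous_const.sub (continuous_const.mul
      (continuous_modeKernel hR s))).measurable).aestronglyMeasurable ?_
  filter_upwards [ae_restrict_of_ae (ae_modeKernel_ne_one hR s)] with p hp
  refine (norm_log_le _).trans ?_
  have := abs_log_norm_one_sub_le (norm_modeKernel hR s p) hp h0 h1
  simp only [Pi.add_apply]
  linarith

/-- Every term except the two mode forms splits over the two points and contains `conj (integ f)` or
`integ g`. -/
theorem integral_Wdamped {R : ℝ} (hR : 0 < R) (c : ℝ) {r : ℝ} (h0 : 0 ≤ r) (h1 : r ≤ 1)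
    {f g : X R → ℂ} {M C C' : ℝ} (hf : IsSlabBounded f M C) (hg : IsSlabBounded g M C') :
    ∫ p : X R × X R, Wdamped R c r p.1 p.2 * conj (f p.1) * g p.2 ∂((σ R).prod (σ R)) =
      c * (conj (integ f) * integ g) - 1 / (4 * Real.pi) *
        (conj (∫ x, logTime R x * f x ∂σ R) * integ g
          + conj (integ f) * (∫ x, logTime R x * g x ∂σ R)
          - (modeForm r 1 f g + modeForm r (-1) f g)) := by
  have if1 := hf.integrable hR
  have ig1 := hg.integrable hR
  have if2 := (hf.mul_left (measurable_logTime R) fun x hx => norm_logTime_le hR hx).integrable hR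
  have ig2 := (hg.mul_left (measurable_logTime R) fun x hx => norm_logTime_le hR hx).integrable hR
  have j0 := integrable_conj_mul_prod if1 ig1
  have j1 := integrable_conj_mul_prod if2 ig1
  have j2 := integrable_conj_mul_prod if1 ig2
  have j3 (s) : Integrable (fun p : X R × X R =>
      -Complex.log (1 - r * modeKernel R s p) * conj (f p.1) * g p.2) ((σ R).prod (σ R)) :=
    hf.integrable_kernel hg (integrableOn_log_modeKernel hR s h0 h1 M).neg
  have e (p : X R × X R) : Wdamped R c r p.1 p.2 * conj (f p.1) * g p.2 =
      c * (conj (f p.1) * g p.2) - 1 / (4 * Real.pi) *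
        ((conj (logTime R p.1 * f p.1) * g p.2 + conj (f p.1) * (logTime R p.2 * g p.2)) -
          (-Complex.log (1 - r * modeKernel R 1 p) * conj (f p.1) * g p.2 +
            -Complex.log (1 - r * modeKernel R (-1) p) * conj (f p.1) * g p.2)) := by
    simp only [Wdamped, modeKernel, map_mul]
    ring
  simp only [e]
  rw [integral_sub (j0.const_mul _), integral_const_mul, integral_const_mul, integral_sub,
    integral_add j1 j2, integral_add (j3 1) (j3 (-1)), integral_conj_mul_prod,
    integral_conj_mul_prod (fun x => logTime R x * f x) g,
    integral_conj_mul_prod f (fun x => logTime R x * g x)]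
  · rfl
  · exact j1.add j2
  · exact (j3 1).add (j3 (-1))
  · exact ((j1.add j2).sub ((j3 1).add (j3 (-1)))).const_mul _

/-! ### Removal of the damping, and positivity -/

theorem tendsto_Wdamped {R : ℝ} (hR : 0 < R) (c : ℝ) {p : X R × X R} (hp1 : modeKernel R 1 p ≠ 1)
    (hp2 : modeKernel R (-1) p ≠ 1) {r : ℕ → ℝ} (hr : Tendsto r atTop (𝓝 1)) :
    Tendsto (fun k => Wdamped R c (r k) p.1 p.2) atTop (𝓝 (Wdamped R c 1 p.1 p.2)) := by
  have hk (s) (hs : modeKernel R s p ≠ 1) :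
      Tendsto (fun k => Complex.log (1 - r k * (conj (mode R s p.1) * mode R s p.2))) atTop
        (𝓝 (Complex.log (1 - (1 : ℝ) * (conj (mode R s p.1) * mode R s p.2)))) := by
    refine Tendsto.clog (tendsto_const_nhds.sub
      (((Complex.continuous_ofReal.tendsto 1).comp hr).mul_const _)) (Or.inl ?_)
    rw [Complex.ofReal_one, one_mul]
    exact re_one_sub_pos (norm_modeKernel hR s p).le hs
  exact tendsto_const_nhds.sub (tendsto_const_nhds.mul
    (tendsto_const_nhds.add ((hk 1 hp1).add (hk (-1) hp2))))

/-- The form is the limit of the damped forms. -/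
theorem tendsto_form {R : ℝ} (hR : 0 < R) (c : ℝ) {f g : X R → ℂ} {M C C' : ℝ}
    (hf : IsSlabBounded f M C) (hg : IsSlabBounded g M C') {r : ℕ → ℝ} (h0 : ∀ k, 0 ≤ r k)
    (h1 : ∀ k, r k ≤ 1) (hr : Tendsto r atTop (𝓝 1)) :
    Tendsto (fun k => ∫ p : X R × X R, Wdamped R c (r k) p.1 p.2 * conj (f p.1) * g p.2
      ∂((σ R).prod (σ R))) atTop (𝓝 (form R c f g)) := by
  have hform : form R c f g = ∫ p : X R × X R, Wdamped R c 1 p.1 p.2 * conj (f p.1) * g p.2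
      ∂((σ R).prod (σ R)) := by
    refine integral_congr_ae ?_
    filter_upwards [ae_W_eq hR c] with p hp
    rw [hp]
  rw [hform]
  have hM := hf.integrable_kernel hg (integrableOn_majorant hR c M).ofReal
  refine tendsto_integral_of_dominated_convergence _ (fun k => ?_) hM.norm (fun k => ?_) ?_
  · exact (((measurable_Wdamped hR c (r k)).mul (Complex.continuous_conj.measurable.comp
      (hf.measurable.comp measurable_fst))).mul
        (hg.measurable.comp measurable_snd)).aestronglyMeasurable
  · filter_upwards [ae_modeKernel_ne_one hR 1, ae_modeKernel_ne_one hR (-1)] with p hp1 hp2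
    by_cases hp : p ∈ slab R M ×ˢ slab R M
    · rw [norm_mul, norm_mul, norm_mul, norm_mul]
      gcongr
      refine (norm_Wdamped_le hR c (h0 k) (h1 k) hp hp1 hp2).trans ?_
      exact (le_abs_self _).trans (by simp)
    · simp only [mem_prod, not_and_or] at hp
      rcases hp with hn | hn
      · simp [hf.eq_zero _ hn]
      · simp [hg.eq_zero _ hn]
  · filter_upwards [ae_modeKernel_ne_one hR 1, ae_modeKernel_ne_one hR (-1)] with p hp1 hp2
    exact ((tendsto_Wdamped hR c hp1 hp2 hr).mul_const _).mul_const _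

theorem exists_damping : ∃ r : ℕ → ℝ, (∀ k, 0 ≤ r k) ∧ (∀ k, r k < 1) ∧ Tendsto r atTop (𝓝 1) := by
  refine ⟨fun k => 1 - 1 / ((k : ℝ) + 1), fun k => ?_, fun k => ?_, ?_⟩
  · rw [sub_nonneg, div_le_one (by positivity)]
    linarith [k.cast_nonneg (α := ℝ)]
  · have : 0 < 1 / ((k : ℝ) + 1) := by positivity
    linarith
  · simpa using tendsto_const_nhds.sub (tendsto_one_div_add_atTop_nhds_zero_nat (𝕜 := ℝ))

theorem re_modeForm_nonneg {R : ℝ} (hR : 0 < R) (s : ℤˣ) {r : ℝ} (h0 : 0 ≤ r) (h1 : r < 1)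
    {f : X R → ℂ} {M C : ℝ} (hf : IsSlabBounded f M C) : 0 ≤ (modeForm r s f f).re := by
  refine (Complex.hasSum_re (hasSum_modeForm hR s h0 h1 hf hf)).nonneg fun n => ?_
  rw [← Complex.normSq_eq_conj_mul_self, ← Complex.ofReal_mul, Complex.ofReal_re]
  exact mul_nonneg (by positivity) (Complex.normSq_nonneg _)

/-- The form is positive semidefinite on functions with zero integral. -/
theorem re_form_self_nonneg {R : ℝ} (hR : 0 < R) (c : ℝ) {f : X R → ℂ} {M C : ℝ}
    (hf : IsSlabBounded f M C) (h : integ f = 0) : 0 ≤ (form R c f f).re := by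
  obtain ⟨r, h0, h1, hr⟩ := exists_damping
  refine ge_of_tendsto' ((Complex.continuous_re.tendsto _).comp
    (tendsto_form hR c hf hf h0 (fun k => (h1 k).le) hr)) fun k => ?_
  rw [Function.comp_apply, integral_Wdamped hR c (h0 k) (h1 k).le hf hf, h]
  have e : (c * (conj (0 : ℂ) * 0) - 1 / (4 * Real.pi) *
      (conj (∫ x, logTime R x * f x ∂σ R) * 0 + conj (0 : ℂ) * (∫ x, logTime R x * f x ∂σ R)
        - (modeForm (r k) 1 f f + modeForm (r k) (-1) f f)) : ℂ) =
      ((1 / (4 * Real.pi) : ℝ) : ℂ) * (modeForm (r k) 1 f f + modeForm (r k) (-1) f f) := by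
    push_cast
    rw [map_zero]
    ring
  rw [e, Complex.re_ofReal_mul, Complex.add_re]
  have := re_modeForm_nonneg hR 1 (h0 k) (h1 k) hf
  have := re_modeForm_nonneg hR (-1) (h0 k) (h1 k) hf
  positivity

/-- The form on functions with zero integral whose modes all vanish. -/
theorem form_eq_of_modeCoeff_eq_zero {R : ℝ} (hR : 0 < R) (c : ℝ) {f g : X R → ℂ} {M C C' : ℝ}
    (hf : IsSlabBounded f M C) (hg : IsSlabBounded g M C') (h : integ f = 0)
    (hm : ∀ s n, modeCoeff s n f = 0) :
    form R c f g = -(1 / (4 * Real.pi)) * (conj (∫ x, logTime R x * f x ∂σ R) * integ g) := by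
  obtain ⟨r, h0, h1, hr⟩ := exists_damping
  refine tendsto_nhds_unique (tendsto_form hR c hf hg h0 (fun k => (h1 k).le) hr) ?_
  refine tendsto_const_nhds.congr fun k => ?_
  have hz (s) : modeForm (r k) s f g = 0 := by
    refine (hasSum_modeForm hR s (h0 k) (h1 k) hf hg).unique ?_
    simp only [hm, map_zero, zero_mul, mul_zero]
    exact hasSum_zero
  rw [integral_Wdamped hR c (h0 k) (h1 k).le hf hg, h, hz, hz]
  simp


/-! ### Green's identity -/

theorem eta_fin_two (u : Fin 2 → ℝ) : ![u 0, u 1] = u := by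
  funext i
  fin_cases i <;> rfl

theorem hasDerivAt_pd_zero {F : (Fin 2 → ℝ) → ℂ} (hF : Differentiable ℝ F) (t θ : ℝ) :
    HasDerivAt (fun τ => F ![τ, θ]) (pd 0 F ![t, θ]) t := by
  have h : HasDerivAt (fun τ : ℝ => ![τ, θ]) (Pi.single 0 1) t := by
    rw [hasDerivAt_pi]
    intro i
    fin_cases i
    · simpa using! hasDerivAt_id' t
    · simpa using hasDerivAt_const t θ
  exact (hF _).hasFDerivAt.comp_hasDerivAt t h

theorem hasDerivAt_pd_one {F : (Fin 2 → ℝ) → ℂ} (hF : Differentiable ℝ F) (t θ : ℝ) :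
    HasDerivAt (fun τ => F ![t, τ]) (pd 1 F ![t, θ]) θ := by
  have h : HasDerivAt (fun τ : ℝ => ![t, τ]) (Pi.single 1 1) θ := by
    rw [hasDerivAt_pi]
    intro i
    fin_cases i
    · simpa using hasDerivAt_const θ t
    · simpa using! hasDerivAt_id' θ
  exact (hF _).hasFDerivAt.comp_hasDerivAt θ h

theorem pd_zero_eq {F : (Fin 2 → ℝ) → ℂ} (hF : Differentiable ℝ F) {d : ℂ} {u : Fin 2 → ℝ}
    (h : HasDerivAt (fun τ => F ![τ, u 1]) d (u 0)) : pd 0 F u = d := by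
  have := hasDerivAt_pd_zero hF (u 0) (u 1)
  rw [eta_fin_two] at this
  exact this.unique h

theorem pd_one_eq {F : (Fin 2 → ℝ) → ℂ} (hF : Differentiable ℝ F) {d : ℂ} {u : Fin 2 → ℝ}
    (h : HasDerivAt (fun τ => F ![u 0, τ]) d (u 1)) : pd 1 F u = d := by
  have := hasDerivAt_pd_one hF (u 0) (u 1)
  rw [eta_fin_two] at this
  exact this.unique h

theorem contDiff_cosh_zero : ContDiff ℝ ∞ fun w : Fin 2 → ℝ => Real.cosh (w 0) :=
  Real.contDiff_cosh.comp (contDiff_apply ℝ ℝ 0)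

theorem contDiff_sech_zero : ContDiff ℝ ∞ fun w : Fin 2 → ℝ => (Real.cosh (w 0))⁻¹ :=
  contDiff_cosh_zero.inv fun w => (Real.cosh_pos (w 0)).ne'

/-- One has `√|g| g^{tt} = cosh t` and `√|g| g^{θθ} = -1 / cosh t`, so `R` survives only in the
overall factor. -/
theorem laplaceBeltrami_eq {R : ℝ} (hR : 0 < R) (F : (Fin 2 → ℝ) → ℂ) (u : Fin 2 → ℝ) :
    laplaceBeltrami R F u = (R ^ 2 * Real.cosh (u 0))⁻¹ •
      (pd 0 (fun w => Real.cosh (w 0) • pd 0 F w) u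
        - pd 1 (fun w => (Real.cosh (w 0))⁻¹ • pd 1 F w) u) := by
  have h0 : (fun w : Fin 2 → ℝ => R ^ 2 * Real.cosh (w 0) * (R ^ 2)⁻¹) =
      fun w => Real.cosh (w 0) := by
    funext w
    field_simp
  have h1 : (fun w : Fin 2 → ℝ => R ^ 2 * Real.cosh (w 0) * -(R ^ 2 * Real.cosh (w 0) ^ 2)⁻¹) =
      fun w => -(Real.cosh (w 0))⁻¹ := by
    funext w
    have := (Real.cosh_pos (w 0)).ne'
    field_simp
  have h2 (i : Fin 2) : pd i (fun _ => (0 : ℂ)) u = 0 := by simp [pd]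
  have h3 : pd 1 (fun w => -(Real.cosh (w 0))⁻¹ • pd 1 F w) u =
      -pd 1 (fun w => (Real.cosh (w 0))⁻¹ • pd 1 F w) u := by
    simp only [neg_smul]
    rw [pd, fderiv_fun_neg]
    rfl
  have e00 (w : Fin 2 → ℝ) : R ^ 2 * Real.cosh (w 0) * (R ^ 2)⁻¹ = Real.cosh (w 0) := congrFun h0 w
  have e11 (w : Fin 2 → ℝ) : R ^ 2 * Real.cosh (w 0) * -(R ^ 2 * Real.cosh (w 0) ^ 2)⁻¹ =
      -(Real.cosh (w 0))⁻¹ := congrFun h1 w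
  simp only [laplaceBeltrami, metric_inv R hR, volDensity_eq, Fin.sum_univ_two, Matrix.of_apply,
    Matrix.cons_val', Matrix.cons_val_zero, Matrix.cons_val_one, Matrix.cons_val_fin_one, mul_zero,
    zero_smul, h2, add_zero, zero_add, e00, e11, h3, sub_eq_add_neg]

theorem pd_mul {F G : (Fin 2 → ℝ) → ℂ} (hF : Differentiable ℝ F) (hG : Differentiable ℝ G)
    (i : Fin 2) (u : Fin 2 → ℝ) :
    pd i (fun w => F w * G w) u = pd i F u * G u + F u * pd i G u := by
  rw [pd, fderiv_fun_mul (hF u) (hG u)]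
  simp [pd]
  ring

theorem pd_sub {F G : (Fin 2 → ℝ) → ℂ} (hF : Differentiable ℝ F) (hG : Differentiable ℝ G)
    (i : Fin 2) (u : Fin 2 → ℝ) : pd i (fun w => F w - G w) u = pd i F u - pd i G u := by
  rw [pd, fderiv_fun_sub (hF u) (hG u)]
  rfl

theorem pd_eq_zero_of_eventuallyEq {F : (Fin 2 → ℝ) → ℂ} {u : Fin 2 → ℝ} (h : F =ᶠ[𝓝 u] 0)
    (i : Fin 2) : pd i F u = 0 := by
  rw [pd, h.fderiv_eq]
  simp

/-- The antisymmetric current `ρ (∂ᵢF G - F ∂ᵢG)`. -/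
def current (ρ : (Fin 2 → ℝ) → ℝ) (i : Fin 2) (F G : (Fin 2 → ℝ) → ℂ) (u : Fin 2 → ℝ) : ℂ :=
  ρ u • pd i F u * G u - F u * ρ u • pd i G u

theorem contDiff_current {ρ : (Fin 2 → ℝ) → ℝ} (hρ : ContDiff ℝ ∞ ρ) (i : Fin 2)
    {F G : (Fin 2 → ℝ) → ℂ} (hF : ContDiff ℝ ∞ F) (hG : ContDiff ℝ ∞ G) :
    ContDiff ℝ ∞ (current ρ i F G) :=
  ((hρ.smul (contDiff_pd hF i)).mul hG).sub (hF.mul (hρ.smul (contDiff_pd hG i)))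

/-- The products `ρ ∂ᵢF ∂ᵢG` cancel by antisymmetry. -/
theorem pd_current {ρ : (Fin 2 → ℝ) → ℝ} (hρ : ContDiff ℝ ∞ ρ) (i : Fin 2)
    {F G : (Fin 2 → ℝ) → ℂ} (hF : ContDiff ℝ ∞ F) (hG : ContDiff ℝ ∞ G) (u : Fin 2 → ℝ) :
    pd i (current ρ i F G) u =
      pd i (fun w => ρ w • pd i F w) u * G u - F u * pd i (fun w => ρ w • pd i G w) u := by
  have hF' : Differentiable ℝ fun w => ρ w • pd i F w :=
    (hρ.smul (contDiff_pd hF i)).differentiable (by simp)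
  have hG' : Differentiable ℝ fun w => ρ w • pd i G w :=
    (hρ.smul (contDiff_pd hG i)).differentiable (by simp)
  have dF := hF.differentiable (by simp)
  have dG := hG.differentiable (by simp)
  refine (pd_sub (hF'.mul dG) (dF.mul hG') i u).trans ?_
  refine (congrArg₂ _ (pd_mul hF' dG i u) (pd_mul dF hG' i u)).trans ?_
  simp only [Complex.real_smul]
  ring

theorem integrable_of_continuous_of_eq_zero {K : ℝ × ℝ → ℂ} (hK : Continuous K) (M : ℝ)
    (h0 : ∀ p : ℝ × ℝ, M < |p.1| → K p = 0) :
    Integrable K ((volume : Measure ℝ).prod (volume.restrict angles)) := by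
  have h1 : IntegrableOn K (Icc (-M) M ×ˢ angles) ((volume : Measure ℝ).prod volume) :=
    (hK.continuousOn.integrableOn_compact (isCompact_Icc.prod isCompact_Icc)).mono_set
      (prod_mono subset_rfl Ioc_subset_Icc_self)
  have h2 : IntegrableOn K (univ ×ˢ angles) ((volume : Measure ℝ).prod volume) := by
    refine h1.of_forall_sdiff_eq_zero (MeasurableSet.univ.prod measurableSet_Ioc) fun p hp => ?_
    refine h0 p (not_le.mp fun h => hp.2 ⟨abs_le.mp h, hp.1.2⟩)
  rwa [IntegrableOn, ← Measure.prod_restrict, Measure.restrict_univ] at h2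

theorem continuous_vec : Continuous fun p : ℝ × ℝ => ![p.1, p.2] := by
  refine continuous_pi fun i => ?_
  fin_cases i
  · exact continuous_fst
  · exact continuous_snd

/-- The divergence theorem on the cylinder, in coordinates. -/
theorem integral_div_eq_zero {J₀ J₁ : (Fin 2 → ℝ) → ℂ} (h₀ : ContDiff ℝ ∞ J₀)
    (h₁ : ContDiff ℝ ∞ J₁) {M : ℝ} (z₀ : ∀ u : Fin 2 → ℝ, M < |u 0| → J₀ u = 0)
    (z₁ : ∀ u : Fin 2 → ℝ, M < |u 0| → J₁ u = 0)
    (hper : ∀ t, J₁ ![t, Real.pi] = J₁ ![t, -Real.pi]) :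
    ∫ p, (pd 0 J₀ ![p.1, p.2] - pd 1 J₁ ![p.1, p.2])
      ∂((volume : Measure ℝ).prod (volume.restrict angles)) = 0 := by
  have hopen : IsOpen {u : Fin 2 → ℝ | M < |u 0|} :=
    isOpen_lt continuous_const (continuous_apply 0).abs
  have hz {J : (Fin 2 → ℝ) → ℂ} (z : ∀ u : Fin 2 → ℝ, M < |u 0| → J u = 0) (i : Fin 2)
      (p : ℝ × ℝ) (hp : M < |p.1|) : pd i J ![p.1, p.2] = 0 := by
    refine pd_eq_zero_of_eventuallyEq ?_ i
    filter_upwards [hopen.mem_nhds (show ![p.1, p.2] ∈ {u : Fin 2 → ℝ | M < |u 0|} from hp)]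
      with u hu
    exact z u hu
  have c0 : Continuous fun p : ℝ × ℝ => pd 0 J₀ ![p.1, p.2] :=
    (contDiff_pd h₀ 0).continuous.comp continuous_vec
  have c1 : Continuous fun p : ℝ × ℝ => pd 1 J₁ ![p.1, p.2] :=
    (contDiff_pd h₁ 1).continuous.comp continuous_vec
  have i0 := integrable_of_continuous_of_eq_zero c0 M (hz z₀ 0)
  have i1 := integrable_of_continuous_of_eq_zero c1 M (hz z₁ 1)
  have d0 := h₀.differentiable (by simp)
  have d1 := h₁.differentiable (by simp)
  -- In `t` the boundary values vanish by the support condition; in `θ`, below, they cancel by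
  -- periodicity.
  have e0 : ∫ p, pd 0 J₀ ![p.1, p.2] ∂((volume : Measure ℝ).prod (volume.restrict angles)) = 0 := by
    refine (integral_prod_symm _ i0).trans ?_
    refine (integral_congr_ae (.of_forall fun θ => ?_)).trans (integral_zero _ _)
    have ct : Continuous fun t : ℝ => pd 0 J₀ ![t, θ] :=
      c0.comp (continuous_id.prodMk continuous_const)
    have it : Integrable fun t : ℝ => pd 0 J₀ ![t, θ] :=
      ct.integrable_of_hasCompactSupport (HasCompactSupport.intro (isCompact_Icc (a := -M) (b := M))
        fun t ht => hz z₀ 0 (t, θ) (not_le.mp fun h => ht (abs_le.mp h)))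
    have l1 : Tendsto (fun t : ℝ => J₀ ![t, θ]) atBot (𝓝 0) := by
      refine tendsto_const_nhds.congr' ?_
      filter_upwards [eventually_lt_atBot (-|M|)] with t ht
      refine (z₀ _ ?_).symm
      exact (le_abs_self M).trans_lt (lt_abs.mpr (Or.inr (lt_neg.mp ht)))
    have l2 : Tendsto (fun t : ℝ => J₀ ![t, θ]) atTop (𝓝 0) := by
      refine tendsto_const_nhds.congr' ?_
      filter_upwards [eventually_gt_atTop M] with t ht
      exact (z₀ _ (lt_abs.mpr (Or.inl ht))).symm
    have := integral_of_hasDerivAt_of_tendsto (fun t => hasDerivAt_pd_zero d0 t θ) it l1 l2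
    simpa using this
  have e1 : ∫ p, pd 1 J₁ ![p.1, p.2] ∂((volume : Measure ℝ).prod (volume.restrict angles)) = 0 := by
    refine (integral_prod _ i1).trans ?_
    refine (integral_congr_ae (.of_forall fun t => ?_)).trans (integral_zero _ _)
    have ct : Continuous fun θ : ℝ => pd 1 J₁ ![t, θ] :=
      c1.comp (continuous_const.prodMk continuous_id)
    have hle : -Real.pi ≤ Real.pi := by linarith [Real.pi_pos]
    have := intervalIntegral.integral_eq_sub_of_hasDerivAt
      (fun θ _ => hasDerivAt_pd_one d1 t θ) (ct.intervalIntegrable (-Real.pi) Real.pi)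
    rw [hper, sub_self, intervalIntegral.integral_of_le hle] at this
    exact this
  rw [integral_sub i0 i1, e0, e1, sub_zero]

theorem contDiff_boxFun {R : ℝ} (hR : 0 < R) {g : X R → ℂ} (hg : ContDiff ℝ ∞ (g ∘ chartX R)) :
    ContDiff ℝ ∞ (boxFun R g ∘ chartX R) := by
  have : boxFun R g ∘ chartX R = laplaceBeltrami R (g ∘ chartX R) :=
    funext fun u => boxFun_chartX hR g u
  rw [this]
  exact contDiff_laplaceBeltrami hR hg

theorem TestFn.integrable {R : ℝ} (hR : 0 < R) (f : TestFn R) : Integrable f.1 (σ R) := by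
  obtain ⟨M, C, h⟩ := exists_isSlabBounded hR f
  exact h.integrable hR

theorem mul_mem_TestFn {R : ℝ} {f g : X R → ℂ} (hf : f ∈ TestFn R)
    (hg : ContDiff ℝ ∞ (g ∘ chartX R)) : (fun x => f x * g x) ∈ TestFn R :=
  ⟨hf.1.mul hg, hf.2.mul_right⟩

/-- The operator `□` is symmetric. -/
theorem integral_box_mul {R : ℝ} (hR : 0 < R) (f : TestFn R) {g : X R → ℂ}
    (hg : ContDiff ℝ ∞ (g ∘ chartX R)) :
    ∫ x, (box hR f).1 x * g x ∂σ R = ∫ x, f.1 x * boxFun R g x ∂σ R := by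
  have hbg := contDiff_boxFun hR hg
  have m1 := mul_mem_TestFn (box hR f).2 hg
  have m2 := mul_mem_TestFn f.2 hbg
  have i1 : Integrable (fun x => (box hR f).1 x * g x) (σ R) := TestFn.integrable hR ⟨_, m1⟩
  have i2 : Integrable (fun x => f.1 x * boxFun R g x) (σ R) := TestFn.integrable hR ⟨_, m2⟩
  have hm : Measurable fun x => (box hR f).1 x * g x - f.1 x * boxFun R g x :=
    (measurable_of_comp_chartX hR m1.1.continuous).sub
      (measurable_of_comp_chartX hR m2.1.continuous)
  rw [← sub_eq_zero, ← integral_sub i1 i2, integral_σ R hm]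
  obtain ⟨M, hM⟩ := exists_slab_of_hasCompactSupport f.2.2
  set F := f.1 ∘ chartX R with hF
  set G := g ∘ chartX R with hG
  have hfF : ContDiff ℝ ∞ F := f.2.1
  have hF0 : ∀ u : Fin 2 → ℝ, M / R < |u 0| → F u = 0 := by
    intro u hu
    refine hM _ fun hmem => ?_
    have : param R (u 0, u 1) ∈ slab R M := by
      rw [param, eta_fin_two]
      exact hmem
    exact absurd (abs_le_of_param_mem_slab hR this) (not_le.mpr hu)
  -- Each term of the current contains `F` or its derivative, so the compact support of `f`
  -- suffices; `g` may be a mode or `logTime`.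
  have hcur (ρ : (Fin 2 → ℝ) → ℝ) (i : Fin 2) (u : Fin 2 → ℝ) (hu : M / R < |u 0|) :
      current ρ i F G u = 0 := by
    have hopen : IsOpen {u : Fin 2 → ℝ | M / R < |u 0|} :=
      isOpen_lt continuous_const (continuous_apply 0).abs
    have hloc : F =ᶠ[𝓝 u] 0 := by
      filter_upwards [hopen.mem_nhds hu] with v hv
      exact hF0 v hv
    rw [current, pd_eq_zero_of_eventuallyEq hloc, hF0 u hu]
    simp
  have hper : ∀ t, current (fun w => (Real.cosh (w 0))⁻¹) 1 F G ![t, Real.pi] =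
      current (fun w => (Real.cosh (w 0))⁻¹) 1 F G ![t, -Real.pi] := by
    intro t
    have hv : ![t, Real.pi] = ![t, -Real.pi] + ![0, ((1 : ℤ) : ℝ) * (2 * Real.pi)] := by
      funext i
      fin_cases i
      · simp
      · simp
        ring
    have pF (w) : F (w + ![0, ((1 : ℤ) : ℝ) * (2 * Real.pi)]) = F w := by
      simp only [hF, Function.comp_apply, chartX_periodic]
    have pG (w) : G (w + ![0, ((1 : ℤ) : ℝ) * (2 * Real.pi)]) = G w := by
      simp only [hG, Function.comp_apply, chartX_periodic]
    simp only [current, hv, pF, pG, pd_periodic pF, pd_periodic pG]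
    simp
  -- After multiplication by the density `R² cosh t`, the integrand `□F * G - F * □G` is the
  -- divergence of these two currents.
  rw [← integral_div_eq_zero (contDiff_current contDiff_cosh_zero 0 hfF hg)
    (contDiff_current contDiff_sech_zero 1 hfF hg) (hcur _ 0) (hcur _ 1) hper]
  refine integral_congr_ae (.of_forall fun p => ?_)
  have hc := (Real.cosh_pos p.1).ne'
  have e1 : (box hR f).1 (param R p) = laplaceBeltrami R F ![p.1, p.2] := boxFun_chartX hR f.1 _
  have e2 : boxFun R g (param R p) = laplaceBeltrami R G ![p.1, p.2] := boxFun_chartX hR g _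
  have e3 : f.1 (param R p) = F ![p.1, p.2] := rfl
  have e4 : g (param R p) = G ![p.1, p.2] := rfl
  simp only [e1, e2, e3, e4, pd_current contDiff_cosh_zero 0 hfF hg,
    pd_current contDiff_sech_zero 1 hfF hg, laplaceBeltrami_eq hR, Complex.real_smul,
    Matrix.cons_val_zero]
  have hc' : (Real.cosh p.1 : ℂ) ≠ 0 := by exact_mod_cast hc
  have hR' : (R : ℂ) ≠ 0 := by exact_mod_cast hR.ne'
  push_cast at hc' ⊢
  field_simp
  ring


/-! ### Solutions of the wave equation -/

theorem boxFun_eq {R : ℝ} (hR : 0 < R) {g : X R → ℂ} {d : ℂ}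
    (h : ∀ u : Fin 2 → ℝ, pd 0 (fun w => Real.cosh (w 0) • pd 0 (g ∘ chartX R) w) u
      - pd 1 (fun w => (Real.cosh (w 0))⁻¹ • pd 1 (g ∘ chartX R) w) u = Real.cosh (u 0) * d)
    (x : X R) : boxFun R g x = d / R ^ 2 := by
  have hc : (Real.cosh (coords R x 0) : ℂ) ≠ 0 := by exact_mod_cast (Real.cosh_pos _).ne'
  have hR' : (R : ℂ) ≠ 0 := by exact_mod_cast hR.ne'
  rw [boxFun, laplaceBeltrami_eq hR, h, Complex.real_smul]
  push_cast at hc ⊢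
  field_simp

theorem logTime_chartX {R : ℝ} (hR : 0 < R) (u : Fin 2 → ℝ) :
    logTime R (chartX R u) = Complex.log (1 - Real.sinh (u 0) * Complex.I) := by
  have : chart R u 0 / R = Real.sinh (u 0) := by
    simp only [chart, Matrix.cons_val_zero]
    field_simp
  rw [logTime, chartX, this]

theorem one_sub_mul_I_mem_slitPlane (a : ℝ) : 1 - (a : ℂ) * Complex.I ∈ Complex.slitPlane :=
  Or.inl (by rw [re_one_sub_mul_I]; exact one_pos)

theorem contDiff_ofReal_comp {n : WithTop ℕ∞} {f : (Fin 2 → ℝ) → ℝ} (hf : ContDiff ℝ n f) :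
    ContDiff ℝ n fun u => (f u : ℂ) :=
  Complex.ofRealCLM.contDiff.comp hf

theorem contDiff_sinh_zero : ContDiff ℝ ∞ fun w : Fin 2 → ℝ => Real.sinh (w 0) :=
  Real.contDiff_sinh.comp (contDiff_apply ℝ ℝ 0)

theorem contDiff_logTime {R : ℝ} (hR : 0 < R) : ContDiff ℝ ∞ (logTime R ∘ chartX R) := by
  have : logTime R ∘ chartX R = fun u => Complex.log (1 - (Real.sinh (u 0) : ℂ) * Complex.I) :=
    funext (logTime_chartX hR)
  rw [this, contDiff_iff_contDiffAt]
  intro u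
  have h1 : ContDiffAt ℝ ∞ (fun u : Fin 2 → ℝ => 1 - (Real.sinh (u 0) : ℂ) * Complex.I) u :=
    (contDiff_const.sub ((contDiff_ofReal_comp contDiff_sinh_zero).mul contDiff_const)).contDiffAt
  have h2 := (Complex.contDiffAt_log (n := ∞)
    (one_sub_mul_I_mem_slitPlane (Real.sinh (u 0)))).restrict_scalars ℝ
  exact h2.comp u h1

theorem hasDerivAt_ofReal_sinh (t : ℝ) :
    HasDerivAt (fun τ : ℝ => (Real.sinh τ : ℂ)) (Real.cosh t) t :=
  (Real.hasDerivAt_sinh t).ofReal_comp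

theorem hasDerivAt_ofReal_cosh (t : ℝ) :
    HasDerivAt (fun τ : ℝ => (Real.cosh τ : ℂ)) (Real.sinh t) t :=
  (Real.hasDerivAt_cosh t).ofReal_comp

theorem ofReal_cosh_sq (t : ℝ) : (Real.cosh t : ℂ) ^ 2 = Real.sinh t ^ 2 + 1 := by
  exact_mod_cast Real.cosh_sq t

/-- Here `cosh t * ∂_t log (1 - i sinh t) = -i cosh² t / (1 - i sinh t) = sinh t - i`, whose
derivative is `cosh t`. -/
theorem boxFun_logTime {R : ℝ} (hR : 0 < R) (x : X R) : boxFun R (logTime R) x = 1 / R ^ 2 := by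
  have hd : Differentiable ℝ (logTime R ∘ chartX R) :=
    (contDiff_logTime hR).differentiable (by simp)
  have h0 : (fun w : Fin 2 → ℝ => Real.cosh (w 0) • pd 0 (logTime R ∘ chartX R) w) =
      fun w => (Real.sinh (w 0) : ℂ) - Complex.I := by
    funext w
    have hne := Complex.slitPlane_ne_zero (one_sub_mul_I_mem_slitPlane (Real.sinh (w 0)))
    have e : pd 0 (logTime R ∘ chartX R) w =
        -(Real.cosh (w 0) * Complex.I) / (1 - Real.sinh (w 0) * Complex.I) := by
      refine pd_zero_eq hd ?_
      simp only [Function.comp_apply, logTime_chartX hR, Matrix.cons_val_zero]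
      exact (((hasDerivAt_ofReal_sinh (w 0)).mul_const Complex.I).const_sub 1).clog_real
        (one_sub_mul_I_mem_slitPlane _)
    rw [e, Complex.real_smul, mul_div_assoc', div_eq_iff hne]
    linear_combination (-Complex.I) * ofReal_cosh_sq (w 0) - Real.sinh (w 0) * Complex.I_sq
  have h1 : pd 1 (logTime R ∘ chartX R) = 0 := by
    funext w
    refine pd_one_eq hd ?_
    simp only [Function.comp_apply, logTime_chartX hR, Matrix.cons_val_zero]
    exact hasDerivAt_const _ _
  refine boxFun_eq hR (fun u => ?_) x
  have h2 : pd 1 (fun _ : Fin 2 → ℝ => (0 : ℂ)) u = 0 := by simp [pd]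
  rw [h0, h1, pd_zero_eq (d := (Real.cosh (u 0) : ℂ))]
  · simp [h2]
  · exact ((contDiff_ofReal_comp contDiff_sinh_zero).sub contDiff_const).differentiable (by simp)
  · simpa [-Complex.ofReal_sinh, -Complex.ofReal_cosh] using
      (hasDerivAt_ofReal_sinh (u 0)).sub_const Complex.I

theorem mode_chartX {R : ℝ} (hR : 0 < R) (s : ℤˣ) (u : Fin 2 → ℝ) :
    mode R s (chartX R u) = (1 + Real.sinh (u 0) * Complex.I) / Real.cosh (u 0) *
      Complex.exp ((s : ℤ) * (u 1 * Complex.I)) := by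
  rw [← mode_param hR, param, eta_fin_two]

theorem contDiff_mode {R : ℝ} (hR : 0 < R) (s : ℤˣ) : ContDiff ℝ ∞ (mode R s ∘ chartX R) := by
  have : mode R s ∘ chartX R = fun u : Fin 2 → ℝ => (1 + (Real.sinh (u 0) : ℂ) * Complex.I) /
      Real.cosh (u 0) * Complex.exp ((s : ℤ) * ((u 1 : ℝ) * Complex.I)) :=
    funext (mode_chartX hR s)
  rw [this]
  simp only [div_eq_mul_inv]
  have h1 := contDiff_ofReal_comp contDiff_sinh_zero
  have h2 := contDiff_ofReal_comp contDiff_cosh_zero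
  have h3 := contDiff_ofReal_comp (n := ∞) (contDiff_apply ℝ ℝ (1 : Fin 2))
  refine ((contDiff_const.add (h1.mul contDiff_const)).mul (h2.inv fun u => ?_)).mul
    (contDiff_const.mul (h3.mul contDiff_const)).cexp
  exact_mod_cast (Real.cosh_pos (u 0)).ne'

/-- The function is `e^{iη}` with `tan η = sinh t`, and `dη/dt = 1 / cosh t`. -/
theorem hasDerivAt_phase (t : ℝ) :
    HasDerivAt (fun τ : ℝ => (1 + (Real.sinh τ : ℂ) * Complex.I) / Real.cosh τ)
      (Complex.I * (Real.cosh t : ℂ)⁻¹ * ((1 + Real.sinh t * Complex.I) / Real.cosh t)) t := by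
  have hc : (Real.cosh t : ℂ) ≠ 0 := by exact_mod_cast (Real.cosh_pos t).ne'
  have := (((hasDerivAt_ofReal_sinh t).mul_const Complex.I).const_add 1).div
    (hasDerivAt_ofReal_cosh t) hc
  refine this.congr_deriv ?_
  rw [div_eq_iff (pow_ne_zero 2 hc)]
  have hs := ofReal_cosh_sq t
  generalize (Real.cosh t : ℂ) = a at *
  generalize (Real.sinh t : ℂ) = b at *
  field_simp
  linear_combination Complex.I * hs - b * Complex.I_sq

theorem pd_zero_mode_pow {R : ℝ} (hR : 0 < R) (s : ℤˣ) (n : ℕ) (u : Fin 2 → ℝ) :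
    pd 0 ((fun x => mode R s x ^ n) ∘ chartX R) u =
      n * Complex.I * (Real.cosh (u 0) : ℂ)⁻¹ * mode R s (chartX R u) ^ n := by
  refine pd_zero_eq (((contDiff_mode hR s).pow n).differentiable (by simp)) ?_
  have h := ((hasDerivAt_phase (u 0)).mul_const
    (Complex.exp ((s : ℤ) * (u 1 * Complex.I)))).fun_pow n
  simp only [Function.comp_apply, mode_chartX hR, Matrix.cons_val_zero, Matrix.cons_val_one,
    Matrix.cons_val_fin_one]
  refine h.congr_deriv ?_
  rcases n with _ | n
  · simp
  · rw [Nat.add_sub_cancel, pow_succ _ n]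
    ring

theorem pd_one_mode_pow {R : ℝ} (hR : 0 < R) (s : ℤˣ) (n : ℕ) (u : Fin 2 → ℝ) :
    pd 1 ((fun x => mode R s x ^ n) ∘ chartX R) u =
      n * Complex.I * (s : ℤ) * mode R s (chartX R u) ^ n := by
  refine pd_one_eq (((contDiff_mode hR s).pow n).differentiable (by simp)) ?_
  have h0 : HasDerivAt (fun τ : ℝ => Complex.exp (((s : ℤˣ) : ℤ) * (τ * Complex.I)))
      (Complex.exp ((s : ℤ) * (u 1 * Complex.I)) * ((s : ℤ) * (1 * Complex.I))) (u 1) :=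
    (((hasDerivAt_id' (u 1)).ofReal_comp.mul_const Complex.I).const_mul _).cexp
  have h := (h0.const_mul ((1 + (Real.sinh (u 0) : ℂ) * Complex.I) / Real.cosh (u 0))).fun_pow n
  simp only [Function.comp_apply, mode_chartX hR, Matrix.cons_val_zero, Matrix.cons_val_one,
    Matrix.cons_val_fin_one]
  refine h.congr_deriv ?_
  rcases n with _ | n
  · simp
  · rw [Nat.add_sub_cancel, pow_succ _ n]
    ring

/-- The modes are solutions of the massless Klein-Gordon equation. -/
theorem boxFun_mode_pow {R : ℝ} (hR : 0 < R) (s : ℤˣ) (n : ℕ) (x : X R) :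
    boxFun R (fun y => mode R s y ^ n) x = 0 := by
  set G := (fun y => mode R s y ^ n) ∘ chartX R with hG
  have hGs : ContDiff ℝ ∞ G := (contDiff_mode hR s).pow n
  have dG : Differentiable ℝ G := hGs.differentiable (by simp)
  have hs : (((s : ℤˣ) : ℤ) : ℂ) ^ 2 = 1 := by
    rcases Int.units_eq_one_or s with rfl | rfl <;> simp
  -- As `cosh t * ∂_t = ∂_η`, the wave equation reads `(∂_η² - ∂_θ²) G = 0`, and `G = e^{in(η +
  -- sθ)}` solves it because `s² = 1`.
  have h0 : (fun w : Fin 2 → ℝ => Real.cosh (w 0) • pd 0 G w) = fun w => n * Complex.I * G w := by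
    funext w
    have hc : (Real.cosh (w 0) : ℂ) ≠ 0 := by exact_mod_cast (Real.cosh_pos _).ne'
    rw [hG, pd_zero_mode_pow hR, Complex.real_smul, Function.comp_apply]
    field_simp
  have h1 (u : Fin 2 → ℝ) : pd 1 (fun w : Fin 2 → ℝ => (Real.cosh (w 0))⁻¹ • pd 1 G w) u =
      (Real.cosh (u 0) : ℂ)⁻¹ * (n * Complex.I * (s : ℤ) * pd 1 G u) := by
    refine pd_one_eq ((contDiff_sech_zero.smul (contDiff_pd hGs 1)).differentiable (by simp)) ?_
    have := hasDerivAt_pd_one dG (u 0) (u 1)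
    rw [eta_fin_two] at this
    have := (this.const_mul (n * Complex.I * (s : ℤ) : ℂ)).const_mul (Real.cosh (u 0) : ℂ)⁻¹
    refine this.congr_of_eventuallyEq (.of_forall fun θ => ?_)
    change (Real.cosh (u 0))⁻¹ • pd 1 G ![u 0, θ] = _
    rw [hG, pd_one_mode_pow hR, Complex.real_smul, Complex.ofReal_inv]
    rfl
  rw [boxFun_eq hR (d := 0) fun u => ?_, zero_div]
  have h2 : pd 0 (fun w => n * Complex.I * G w) u = n * Complex.I * pd 0 G u := by
    rw [pd, fderiv_const_mul (dG u)]
    rfl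
  rw [h0, h1, h2, hG, pd_zero_mode_pow hR, pd_one_mode_pow hR]
  linear_combination (-(n : ℂ) ^ 2 * Complex.I ^ 2 * (Real.cosh (u 0) : ℂ)⁻¹ *
    mode R s (chartX R u) ^ n) * hs


/-! ### The vector `v₀` -/

theorem integral_v₀_mul {R : ℝ} (hR : 0 < R) (h : TestFn R) {g : X R → ℂ}
    (hg : ContDiff ℝ ∞ (g ∘ chartX R)) :
    ∫ x, g x * (v₀ hR h).1 x ∂σ R = -4 * Real.pi * R ^ 2 * ∫ x, h.1 x * boxFun R g x ∂σ R := by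
  rw [← integral_box_mul hR h hg, ← integral_const_mul]
  refine integral_congr_ae (.of_forall fun x => ?_)
  have : (v₀ hR h).1 x = ((-4 * Real.pi * R ^ 2 : ℝ) : ℂ) * (box hR h).1 x := rfl
  simp only [this]
  push_cast
  ring

theorem integral_mode_pow_mul_v₀ {R : ℝ} (hR : 0 < R) (h : TestFn R) (s : ℤˣ) (n : ℕ) :
    ∫ x, mode R s x ^ n * (v₀ hR h).1 x ∂σ R = 0 := by
  rw [integral_v₀_mul hR h (g := fun x => mode R s x ^ n) ((contDiff_mode hR s).pow n)]
  simp [boxFun_mode_pow hR]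

/-- The zeroth power of a mode is the constant function `1`. -/
theorem integ_v₀ {R : ℝ} (hR : 0 < R) (h : TestFn R) : integ (v₀ hR h).1 = 0 := by
  simpa [integ] using integral_mode_pow_mul_v₀ hR h 1 0

/-- Since `□ logTime` is the constant `1/R²`, this pairing sees `h` only through `∫ h = 1`, which
makes the class of `v₀` independent of `h`. -/
theorem integral_logTime_mul_v₀ {R : ℝ} (hR : 0 < R) (h : TestFn R) (h1 : integ h.1 = 1) :
    ∫ x, logTime R x * (v₀ hR h).1 x ∂σ R = -4 * Real.pi := by
  have hR' : (R : ℂ) ≠ 0 := by exact_mod_cast hR.ne'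
  have h1' : ∫ x, h.1 x ∂σ R = 1 := h1
  rw [integral_v₀_mul hR h (contDiff_logTime hR)]
  simp only [boxFun_logTime hR]
  rw [integral_mul_const, h1']
  field_simp

/-- All mode coefficients and the integral of `v₀` vanish, so only the `logTime` term is left, and
`-(1/4π)(-4π) = 1`. -/
theorem form_v₀ {R : ℝ} (hR : 0 < R) (c : ℝ) (h : TestFn R) (h1 : integ h.1 = 1) (f : TestFn R) :
    form R c (v₀ hR h) f = integ f.1 := by
  obtain ⟨M, C, hf⟩ := exists_isSlabBounded hR f
  obtain ⟨M', C', hv⟩ := exists_isSlabBounded hR (v₀ hR h)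
  have hpi : (Real.pi : ℂ) ≠ 0 := by exact_mod_cast Real.pi_ne_zero
  rw [form_eq_of_modeCoeff_eq_zero hR c (hv.mono (le_max_left M' M) le_rfl)
    (hf.mono (le_max_right M' M) le_rfl) (integ_v₀ hR h)
    (fun s n => integral_mode_pow_mul_v₀ hR h s (n + 1)), integral_logTime_mul_v₀ hR h h1]
  simp only [map_mul, map_neg, Complex.conj_ofReal, map_ofNat]
  field_simp

/-! ### The Krein product -/

theorem mink_sub_comm (x y : Fin 3 → ℝ) : mink (x - y) (x - y) = mink (y - x) (y - x) := by
  simp only [mink, Pi.sub_apply]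
  ring

theorem conj_W (R c : ℝ) (x x' : Fin 3 → ℝ) : conj (W R c x' x) = W R c x x' := by
  have hs : Real.sign (x' 0 - x 0) = -Real.sign (x 0 - x' 0) := by
    rw [← Real.sign_neg, neg_sub]
  simp only [W, mink_sub_comm x' x, hs]
  split_ifs <;> simp [Complex.conj_ofNat]

theorem conj_form (R c : ℝ) (f g : X R → ℂ) : conj (form R c g f) = form R c f g := by
  rw [form, ← integral_conj, ← integral_prod_swap, form]
  refine integral_congr_ae (.of_forall fun p => ?_)
  simp only [Prod.fst_swap, Prod.snd_swap, map_mul, conj_W, Complex.conj_conj]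
  ring

theorem integrable_form {R : ℝ} (hR : 0 < R) (c : ℝ) (f g : TestFn R) :
    Integrable (fun p : X R × X R => W R c p.1 p.2 * conj (f.1 p.1) * g.1 p.2)
      ((σ R).prod (σ R)) := by
  obtain ⟨M, C, hf⟩ := exists_isSlabBounded hR f
  obtain ⟨M', C', hg⟩ := exists_isSlabBounded hR g
  exact (hf.mono (le_max_left M M') le_rfl).integrable_kernel (hg.mono (le_max_right M M') le_rfl)
    (integrableOn_W hR c _)

theorem form_add_left {R : ℝ} (hR : 0 < R) (c : ℝ) (f₁ f₂ g : TestFn R) :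
    form R c (f₁ + f₂ : TestFn R) g = form R c f₁ g + form R c f₂ g := by
  refine Eq.trans ?_ (integral_add (integrable_form hR c f₁ g) (integrable_form hR c f₂ g))
  refine integral_congr_ae (.of_forall fun p => ?_)
  simp only [Submodule.coe_add, Pi.add_apply, map_add]
  ring

theorem form_smul_left {R : ℝ} (c : ℝ) (f g : TestFn R) (a : ℂ) :
    form R c (a • f : TestFn R) g = conj a * form R c f g := by
  refine Eq.trans ?_ (integral_const_mul _ _)
  refine integral_congr_ae (.of_forall fun p => ?_)
  simp only [Submodule.coe_smul, Pi.smul_apply, smul_eq_mul, map_mul]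
  ring

theorem form_sub_left {R : ℝ} (hR : 0 < R) (c : ℝ) (f₁ f₂ g : TestFn R) :
    form R c (f₁ - f₂ : TestFn R) g = form R c f₁ g - form R c f₂ g := by
  rw [eq_sub_iff_add_eq, ← form_add_left hR, sub_add_cancel]

theorem integ_add {R : ℝ} (hR : 0 < R) (f g : TestFn R) :
    integ (f + g : TestFn R).1 = integ f.1 + integ g.1 :=
  integral_add (TestFn.integrable hR f) (TestFn.integrable hR g)

theorem integ_smul {R : ℝ} (a : ℂ) (f : TestFn R) : integ (a • f : TestFn R).1 = a * integ f.1 :=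
  integral_const_mul a _

theorem integ_sub {R : ℝ} (hR : 0 < R) (f g : TestFn R) :
    integ (f - g : TestFn R).1 = integ f.1 - integ g.1 :=
  integral_sub (TestFn.integrable hR f) (TestFn.integrable hR g)

theorem integ_zeroPart {R : ℝ} (hR : 0 < R) {h : TestFn R} (h1 : integ h.1 = 1) (f : TestFn R) :
    integ (zeroPart h f).1 = 0 := by
  rw [zeroPart, integ_sub hR, integ_smul, h1, mul_one, sub_self]

theorem zeroPart_add {R : ℝ} (hR : 0 < R) (h f g : TestFn R) :
    zeroPart h (f + g) = zeroPart h f + zeroPart h g := by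
  rw [zeroPart, zeroPart, zeroPart, integ_add hR, add_smul]
  abel

theorem zeroPart_smul {R : ℝ} (h f : TestFn R) (a : ℂ) :
    zeroPart h (a • f) = a • zeroPart h f := by
  rw [zeroPart, zeroPart, integ_smul, mul_smul, smul_sub]

theorem zeroPart_of_integ_eq_zero {R : ℝ} (h : TestFn R) {f : TestFn R} (hf : integ f.1 = 0) :
    zeroPart h f = f := by
  rw [zeroPart, hf, zero_smul, sub_zero]

theorem re_form_zeroPart_nonneg {R : ℝ} (hR : 0 < R) (c : ℝ) {h : TestFn R} (h1 : integ h.1 = 1)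
    (f : TestFn R) : 0 ≤ (form R c (zeroPart h f) (zeroPart h f)).re := by
  obtain ⟨M, C, hf⟩ := exists_isSlabBounded hR (zeroPart h f)
  exact re_form_self_nonneg hR c hf (integ_zeroPart hR h1 f)

/-- When `∫ h = 1` the three summands are nonnegative; this gives both semidefiniteness and the
description of the null vectors. -/
theorem re_krein_self (R c : ℝ) (h f : TestFn R) :
    (krein R c h f f).re = (form R c (zeroPart h f) (zeroPart h f)).re +
      Complex.normSq (form R c h f) + Complex.normSq (integ f.1) := by
  rw [krein, ← conj_form R c f h, ← Complex.normSq_eq_conj_mul_self,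
    ← Complex.normSq_eq_conj_mul_self]
  simp

theorem isPreHilbert {R : ℝ} (hR : 0 < R) (c : ℝ) {h : TestFn R} (h1 : integ h.1 = 1) :
    IsPreHilbert R c h where
  conj_symm f g := by
    simp only [krein, map_add, map_mul, conj_form, Complex.conj_conj]
    ring
  re_nonneg f := by
    rw [re_krein_self]
    have := re_form_zeroPart_nonneg hR c h1 f
    have := Complex.normSq_nonneg (form R c h f)
    have := Complex.normSq_nonneg (integ f.1)
    positivity
  add_left f₁ f₂ g := by
    simp only [krein, zeroPart_add hR, form_add_left hR, integ_add hR, map_add]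
    ring
  smul_left f g a := by
    simp only [krein, zeroPart_smul, form_smul_left, integ_smul, map_mul]
    ring

theorem krein_self_eq_zero_iff {R : ℝ} (hR : 0 < R) (c : ℝ) {h : TestFn R} (h1 : integ h.1 = 1)
    (f : TestFn R) : krein R c h f f = 0 ↔ f ∈ nullIdeal R c h := by
  constructor
  · intro h0
    have hre := re_krein_self R c h f
    rw [h0, Complex.zero_re] at hre
    have p1 := re_form_zeroPart_nonneg hR c h1 f
    have p2 := Complex.normSq_nonneg (form R c h f)
    have p3 := Complex.normSq_nonneg (integ f.1)
    refine ⟨Complex.normSq_eq_zero.mp (by linarith), Complex.ext ?_ ?_,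
      Complex.normSq_eq_zero.mp (by linarith)⟩
    · rw [Complex.zero_re]
      linarith
    · exact Complex.conj_eq_iff_im.mp (conj_form R c _ _)
  · rintro ⟨e1, e2, e3⟩
    rw [krein, e1, e2, e3]
    simp

/-- By `form_v₀`, `⟨v₀, f₀⟩ = ∫ f₀ = 0` and `⟨v₀, h⟩ = ∫ h = 1`; with `∫ v₀ = 0` only the middle
term of the Krein product survives. -/
theorem krein_v₀ {R : ℝ} (hR : 0 < R) (c : ℝ) {h : TestFn R} (h1 : integ h.1 = 1) (f : TestFn R) :
    krein R c h (v₀ hR h) f = form R c h f := by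
  rw [krein, zeroPart_of_integ_eq_zero h (integ_v₀ hR h), form_v₀ hR c h h1, form_v₀ hR c h h1,
    integ_zeroPart hR h1, integ_v₀, h1]
  simp

/-- Both vectors represent the functional `f ↦ ∫ f` for the form, so their difference is annihilated
by every test function. -/
theorem v₀_sub_mem_nullIdeal {R : ℝ} (hR : 0 < R) (c : ℝ) {h h' : TestFn R} (h1 : integ h.1 = 1)
    (h1' : integ h'.1 = 1) : v₀ hR h' - v₀ hR h ∈ nullIdeal R c h := by
  have hi : integ (v₀ hR h' - v₀ hR h : TestFn R).1 = 0 := by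
    rw [integ_sub hR, integ_v₀, integ_v₀, sub_zero]
  have hf (f : TestFn R) : form R c (v₀ hR h' - v₀ hR h : TestFn R) f = 0 := by
    rw [form_sub_left hR, form_v₀ hR c h' h1', form_v₀ hR c h h1, sub_self]
  refine ⟨hi, ?_, ?_⟩
  · rw [zeroPart_of_integ_eq_zero h hi, hf]
  · rw [← conj_form, hf, map_zero]

/-- `(v₀, v₀) = ⟨h, v₀⟩ = conj ⟨v₀, h⟩ = conj (∫ h) = 1`. -/
theorem norm_toK₁_v₀ {R : ℝ} (hR : 0 < R) {c : ℝ} {h : TestFn R} (H : IsPreHilbert R c h)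
    (h1 : integ h.1 = 1) : ‖toK₁ H (v₀ hR h)‖ = 1 := by
  have h2 : inner ℂ (toK₁ H (v₀ hR h)) (toK₁ H (v₀ hR h)) = (1 : ℂ) := by
    rw [inner_toK₁, krein_v₀ hR c h1, ← conj_form, form_v₀ hR c h h1, h1, map_one]
  have h3 : ‖toK₁ H (v₀ hR h)‖ ^ 2 = 1 :=
    (norm_sq_eq_re_inner (𝕜 := ℂ) _).trans (congrArg Complex.re h2)
  exact (pow_eq_one_iff_of_nonneg (norm_nonneg _) two_ne_zero).mp h3

end DeSitter

end

/-! ### The theorem -/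

open DeSitter
theorem mainTheorem5 (R : ℝ) (hR : 0 < R) (c : ℝ)
    (h : TestFn R) (hh : IsAdmissible R c h) :
    MeasureTheory.LocallyIntegrable (fun p : X R × X R => W R c p.1 p.2)
      ((σ R).prod (σ R)) ∧
    ∃ H : IsPreHilbert R c h,
      (∀ f : TestFn R, krein R c h f f = 0 ↔ f ∈ nullIdeal R c h) ∧
      (∃ F : K₁ H →L[ℂ] ℂ,
        (∀ f : TestFn R, F (toK₁ H f) = form R c h f) ∧
        ‖F‖ = 1 ∧
        (∀ u : K₁ H, inner ℂ (toK₁ H (v₀ hR h)) u = F u) ∧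
        ‖toK₁ H (v₀ hR h)‖ = 1) ∧
      (∀ h' : TestFn R, IsAdmissible R c h' → v₀ hR h' - v₀ hR h ∈ nullIdeal R c h) ∧
      form R c (v₀ hR h) (v₀ hR h) = 0 ∧
      ∀ f : TestFn R, form R c (v₀ hR h) f = integ f.1 := by
  have h1 := hh.integral_eq_one
  have H := isPreHilbert hR c h1
  -- The functional is taken to be the inner product with the class of `v₀`: it is then represented
  -- by `v₀` by definition, its norm is that of `v₀`, and it remains to identify its values on test
  -- functions.
  refine ⟨locallyIntegrable_W hR c, H, krein_self_eq_zero_iff hR c h1,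
    ⟨innerSL ℂ (toK₁ H (v₀ hR h)), fun f => ?_, ?_, fun u => rfl, norm_toK₁_v₀ hR H h1⟩,
    fun h' hh' => v₀_sub_mem_nullIdeal hR c h1 hh'.integral_eq_one, ?_, form_v₀ hR c h h1⟩
  · rw [innerSL_apply_apply, inner_toK₁, krein_v₀ hR c h1]
  · rw [innerSL_apply_norm, norm_toK₁_v₀ hR H h1]
  · rw [form_v₀ hR c h h1, integ_v₀]
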